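/- **Conventions.** A compact quantum group $G$ is given by a unital $C^*$-algebra $C(G)$ with a coassociative unital $*$-homomorphism $\Delta:C(G)\to C(G)\otimes C(G)$ satisfying the usual density conditions; a morphism $K\to G$ is a unital $*$-homomorphism $C(G)\to C(K)$ commuting with the comultiplications. For a discrete group $\Gamma$ with finite generating set $S=S^{-1}\not\ni1$ and word length $l$, let $D$ be the operator $D\delta_g=l(g)\delta_g$ on $\ell^2(\Gamma)$, and let $G^+(\widehat\Gamma)$ be the universal compact quantum group acting on $C^*(\Gamma)$ such that the eigenspaces of $D$ and the standard trace $tr(g)=\delta_{g,1}$ on $\mathbb C\Gamma$ are invariant: every compact quantum group acting in this way does so through a unique morphism to $G^+(\widehat\Gamma)$. For $\Gamma=\mathbb Z_s^{*n}$ or $\Gamma=F_n$ with standard generators $g_1,\ldots,g_n$, take $S=\{g_{ia}\mid 1\le i\le n,\ a=1,2\}$ with $g_{i1}=g_i$, $g_{i2}=g_i^{-1}$, and let $u=(u_{jb,ia})$ be the matrix of elements of $C(G^+(\widehat\Gamma))$ with $\alpha(g_{ia})=\sum_{jb}g_{jb}\otimes u_{jb,ia}$, where $\alpha$ is the action. Put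 $H_{n0}^+=G^+(\widehat{F_n})$. **Theorem.** Let $s\ge5$ and $n\ge2$ be integers. Then $G^+(\widehat{F_n})$ and $G^+(\widehat{\mathbb Z_s^{*n}})$ exist, and $G^+(\widehat{\mathbb Z_s^{*n}})$ is the quantum subgroup of $H_{n0}^+$ presented by the relation $\xi\in Fix(u^{\otimes s})$, where $\xi=\sum_{ia}e_{ia}^{\otimes s}\in(\mathbb C^{2n})^{\otimes s}$. That is, there is a surjective morphism $\pi:C(H_{n0}^+)\to C(G^+(\widehat{\mathbb Z_s^{*n}}))$, commuting with the comultiplications and mapping each $u_{jb,ia}$ to the corresponding generator, and it makes $C(G^+(\widehat{\mathbb Z_s^{*n}}))$ the universal $C^*$-algebra obtained from $C(H_{n0}^+)$ by imposing the relations given by the coordinates of $u^{\otimes s}(\xi\otimes1)=\xi\otimes1$, i.e. $$\sum_{ia}u_{j_1b_1,ia}\cdots u_{j_sb_s,ia}=\begin{cases}1&\text{if }(j_1b_1)=\cdots=(j_sb_s),\\0&\text{otherwise.}\end{cases}$$ -/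

import Mathlib

open scoped TensorProduct ENNReal InnerProductSpace

universe u

noncomputable section

/-! ### States of unital C*-algebras and their GNS representations -/

section States

open scoped ComplexOrder

/-- A state of a unital C*-algebra: a linear functional `φ` with `φ (a* a) ≥ 0` and `φ 1 = 1`. -/
structure CState (A : Type u) [CStarAlgebra A] where
  toLin : A →ₗ[ℂ] ℂ
  nonneg : ∀ a, 0 ≤ toLin (star a * a)
  map_one : toLin 1 = 1

namespace CState

variable {A : Type u} [CStarAlgebra A]

/-- The same functional as one of Mathlib's positive linear maps, for a given C*-order on `A`. -/
def toPositive [PartialOrder A] [StarOrderedRing A] (φ : CState A) : A →ₚ[ℂ] ℂ :=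
  PositiveLinearMap.mk₀ φ.toLin (by
    intro x hx
    obtain ⟨b, rfl⟩ := CStarAlgebra.nonneg_iff_eq_star_mul_self.1 hx
    exact φ.nonneg b)

/-- The restriction `φ ∘ f` of a state along a unital `*`-homomorphism. -/
def comp {B : Type u} [CStarAlgebra B] (φ : CState B) (f : A →⋆ₐ[ℂ] B) : CState A where
  toLin := φ.toLin ∘ₗ f.toAlgHom.toLinearMap
  nonneg a := by
    have h := φ.nonneg (f a)
    rwa [← map_star, ← map_mul] at h
  map_one := by simpa using φ.map_one

/-- The GNS space of a state, with respect to the canonical order of the C*-algebra. -/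
abbrev Space (φ : CState A) : Type u :=
  letI := CStarAlgebra.spectralOrder A
  haveI := CStarAlgebra.spectralOrderedRing A
  φ.toPositive.GNS

/-- The GNS representation of a state. -/
def rep (φ : CState A) : A →⋆ₐ[ℂ] (φ.Space →L[ℂ] φ.Space) :=
  letI := CStarAlgebra.spectralOrder A
  haveI := CStarAlgebra.spectralOrderedRing A
  φ.toPositive.gnsStarAlgHom

/-- The cyclic vector of the GNS representation: the class of the unit. -/
def vec (φ : CState A) : φ.Space :=
  letI := CStarAlgebra.spectralOrder A
  haveI := CStarAlgebra.spectralOrderedRing A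
  ((φ.toPositive.toPreGNS 1 : φ.toPositive.PreGNS) : φ.toPositive.GNS)

lemma norm_vec (φ : CState A) : ‖φ.vec‖ = 1 := by
  let _ := CStarAlgebra.spectralOrder A
  have _ := CStarAlgebra.spectralOrderedRing A
  have h : ‖(φ.toPositive.toPreGNS 1 : φ.toPositive.PreGNS)‖ = 1 := by
    rw [PositiveLinearMap.preGNS_norm_def]
    have : φ.toPositive (1 : A) = 1 := φ.map_one
    simp [this]
  simpa [vec] using h

end CState

end States

/-! ### The minimal (spatial) tensor product of two unital C*-algebras

It is realized as the closed `*`-subalgebra generated by the operators `a ⊗ b` inside the product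
of the algebras of bounded operators on the Hilbert spaces `H_φ ⊗ H_ψ`, where `φ`, `ψ` run through
all states. Since the direct sum of all GNS representations is faithful, this is the usual spatial
tensor product. -/

section MinTensor

open UniformSpace

variable (A B : Type u) [CStarAlgebra A] [CStarAlgebra B]

/-- The Hilbert space tensor product of the GNS spaces of two states. -/
abbrev GNSTensor (p : CState A × CState B) : Type u :=
  Completion (p.1.Space ⊗[ℂ] p.2.Space)

variable {A B} in
/-- The tensor product of the two cyclic vectors. -/
def gnsTensorVec (p : CState A × CState B) : GNSTensor A B p :=
  ((p.1.vec ⊗ₜ[ℂ] p.2.vec : p.1.Space ⊗[ℂ] p.2.Space) : Completion (p.1.Space ⊗[ℂ] p.2.Space))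

lemma norm_gnsTensorVec (p : CState A × CState B) : ‖gnsTensorVec p‖ = 1 := by
  rw [gnsTensorVec, Completion.norm_coe, TensorProduct.norm_tmul, CState.norm_vec,
    CState.norm_vec, one_mul]

instance (p : CState A × CState B) : Nontrivial (GNSTensor A B p) :=
  ⟨⟨gnsTensorVec p, 0, fun h => by simpa [h] using norm_gnsTensorVec A B p⟩⟩

/-- The algebra of bounded operators on `H_φ ⊗ H_ψ`. -/
abbrev GNSTensorOp (p : CState A × CState B) : Type u :=
  GNSTensor A B p →L[ℂ] GNSTensor A B p

instance (p : CState A × CState B) : CStarAlgebra (GNSTensorOp A B p) where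

/-- The product of all these algebras (bounded families with the supremum norm). -/
abbrev GNSTensorProd : Type u := lp (GNSTensorOp A B) ∞

instance : CStarAlgebra (GNSTensorProd A B) where

variable {A B}

/-- The operator `π_φ(a) ⊗ π_ψ(b)` on `H_φ ⊗ H_ψ`. -/
def gnsTensorOp (a : A) (b : B) (p : CState A × CState B) : GNSTensorOp A B p :=
  (TensorProduct.mapL (p.1.rep a) (p.2.rep b)).completion

lemma gnsTensorOp_coe (a : A) (b : B) (p : CState A × CState B) (x : p.1.Space ⊗[ℂ] p.2.Space) :
    gnsTensorOp a b p (x : GNSTensor A B p) =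
      ((TensorProduct.mapL (p.1.rep a) (p.2.rep b) x : p.1.Space ⊗[ℂ] p.2.Space) :
        GNSTensor A B p) :=
  ContinuousLinearMap.completion_apply_coe _ _

lemma norm_gnsTensorOp_le (a : A) (b : B) (p : CState A × CState B) :
    ‖gnsTensorOp a b p‖ ≤ ‖a‖ * ‖b‖ := by
  have h : ‖TensorProduct.mapL (p.1.rep a) (p.2.rep b)‖ ≤ ‖a‖ * ‖b‖ :=
    (TensorProduct.norm_mapL_le _ _).trans
      (mul_le_mul (NonUnitalStarAlgHom.norm_apply_le _ a) (NonUnitalStarAlgHom.norm_apply_le _ b)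
        (norm_nonneg _) (norm_nonneg _))
  refine ContinuousLinearMap.opNorm_le_bound _ (by positivity) fun x => ?_
  induction x using Completion.induction_on with
  | hp => exact isClosed_le (by fun_prop) (by fun_prop)
  | ih x =>
    rw [gnsTensorOp_coe, Completion.norm_coe, Completion.norm_coe]
    exact ContinuousLinearMap.le_of_opNorm_le _ h x

/-- Two bounded operators on `H_φ ⊗ H_ψ` agree if they agree on elementary tensors. -/
lemma gnsTensorOp_ext {p : CState A × CState B} {S T : GNSTensorOp A B p}
    (h : ∀ (x : p.1.Space) (y : p.2.Space),
      S ((x ⊗ₜ[ℂ] y : p.1.Space ⊗[ℂ] p.2.Space) : GNSTensor A B p) =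
        T ((x ⊗ₜ[ℂ] y : p.1.Space ⊗[ℂ] p.2.Space) : GNSTensor A B p)) : S = T := by
  ext z
  induction z using Completion.induction_on with
  | hp => exact isClosed_eq (by fun_prop) (by fun_prop)
  | ih z =>
    induction z using TensorProduct.induction_on with
    | zero => rw [Completion.coe_zero, map_zero, map_zero]
    | tmul x y => exact h x y
    | add x y hx hy => rw [Completion.coe_add, map_add, map_add, hx, hy]

/-- The family of the operators `π_φ(a) ⊗ π_ψ(b)`. -/
def gnsTmul (a : A) (b : B) : GNSTensorProd A B :=
  ⟨gnsTensorOp a b, memℓp_infty ⟨‖a‖ * ‖b‖, by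
    rintro _ ⟨p, rfl⟩
    exact norm_gnsTensorOp_le a b p⟩⟩

variable (A B) in
/-- The closed `*`-subalgebra generated by the families `a ⊗ b`. -/
def minTensorSubalgebra : StarSubalgebra ℂ (GNSTensorProd A B) :=
  (StarAlgebra.adjoin ℂ {x : GNSTensorProd A B | ∃ a b, x = gnsTmul a b}).topologicalClosure

variable (A B) in
/-- The minimal tensor product `A ⊗ B` of C*-algebras. -/
def MinTensor : Type u := minTensorSubalgebra A B

instance : CStarAlgebra (MinTensor A B) :=
  haveI : IsClosed (minTensorSubalgebra A B : Set (GNSTensorProd A B)) :=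
    StarSubalgebra.isClosed_topologicalClosure _
  inferInstanceAs (CStarAlgebra (minTensorSubalgebra A B))

namespace MinTensor

/-- The elementary tensor `a ⊗ b`. -/
def tmul (a : A) (b : B) : MinTensor A B :=
  ⟨gnsTmul a b, StarSubalgebra.le_topologicalClosure _
    (StarAlgebra.subset_adjoin ℂ _ ⟨a, b, rfl⟩)⟩

/-- The component of an element in the representation on `H_φ ⊗ H_ψ`. -/
def component (x : MinTensor A B) (p : CState A × CState B) : GNSTensorOp A B p :=
  (show GNSTensorProd A B from x.1) p

lemma ext_component {x y : MinTensor A B} (h : ∀ p, x.component p = y.component p) : x = y :=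
  Subtype.ext (lp.ext (funext h))

lemma component_add (x y : MinTensor A B) (p : CState A × CState B) :
    (x + y).component p = x.component p + y.component p := rfl

lemma component_smul (c : ℂ) (x : MinTensor A B) (p : CState A × CState B) :
    (c • x).component p = c • x.component p := rfl

lemma component_mul (x y : MinTensor A B) (p : CState A × CState B) :
    (x * y).component p = x.component p * y.component p := rfl

lemma component_star (x : MinTensor A B) (p : CState A × CState B) :
    (star x).component p = star (x.component p) := rfl

lemma component_one (p : CState A × CState B) : (1 : MinTensor A B).component p = 1 := rfl

lemma component_tmul_apply (a : A) (b : B) (p : CState A × CState B)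
    (x : p.1.Space) (y : p.2.Space) :
    (tmul a b).component p ((x ⊗ₜ[ℂ] y : p.1.Space ⊗[ℂ] p.2.Space) : GNSTensor A B p) =
      ((p.1.rep a x ⊗ₜ[ℂ] p.2.rep b y : p.1.Space ⊗[ℂ] p.2.Space) : GNSTensor A B p) :=
  gnsTensorOp_coe a b p _

/-- The canonical linear map from the algebraic tensor product. -/
def ofTensor : A ⊗[ℂ] B →ₗ[ℂ] MinTensor A B :=
  TensorProduct.lift <| LinearMap.mk₂ ℂ tmul
    (fun a a' b => ext_component fun p => gnsTensorOp_ext fun x y => by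
      rw [component_add, add_apply]
      simp only [component_tmul_apply, map_add, add_apply,
        TensorProduct.add_tmul, Completion.coe_add])
    (fun c a b => ext_component fun p => gnsTensorOp_ext fun x y => by
      rw [component_smul, smul_apply]
      simp only [component_tmul_apply, map_smul, smul_apply,
        ← TensorProduct.smul_tmul', Completion.coe_smul])
    (fun a b b' => ext_component fun p => gnsTensorOp_ext fun x y => by
      rw [component_add, add_apply]
      simp only [component_tmul_apply, map_add, add_apply,
        TensorProduct.tmul_add, Completion.coe_add])
    (fun c a b => ext_component fun p => gnsTensorOp_ext fun x y => by
      rw [component_smul, smul_apply]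
      simp only [component_tmul_apply, map_smul, smul_apply,
        TensorProduct.tmul_smul, Completion.coe_smul])

end MinTensor

open scoped ComplexOrder in
/-- The product state `φ ⊗ ψ` on `A ⊗ B`, i.e. the vector state of the tensor product of the two
cyclic vectors. -/
def CState.prod (φ : CState A) (ψ : CState B) : CState (MinTensor A B) where
  toLin :=
    { toFun := fun x => ⟪gnsTensorVec (φ, ψ), x.component (φ, ψ) (gnsTensorVec (φ, ψ))⟫_ℂ
      map_add' := fun x y => by
        rw [MinTensor.component_add, add_apply, inner_add_right]
      map_smul' := fun c x => by
        rw [MinTensor.component_smul, smul_apply, inner_smul_right]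
        rfl }
  nonneg x := by
    change 0 ≤ ⟪gnsTensorVec (φ, ψ), (star x * x).component (φ, ψ) (gnsTensorVec (φ, ψ))⟫_ℂ
    rw [MinTensor.component_mul, MinTensor.component_star, mul_apply_eq_comp,
      ContinuousLinearMap.star_eq_adjoint, ContinuousLinearMap.adjoint_inner_right,
      inner_self_eq_norm_sq_to_K]
    norm_cast
    positivity
  map_one := by
    change ⟪gnsTensorVec (φ, ψ), (1 : MinTensor A B).component (φ, ψ)
      (gnsTensorVec (φ, ψ))⟫_ℂ = 1
    rw [MinTensor.component_one, one_apply_eq_self, inner_self_eq_norm_sq_to_K,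
      norm_gnsTensorVec]
    simp

end MinTensor

/-! ### Compact quantum groups -/

/-- The convolution `(φ ⊗ ψ) ∘ Δ` of two states along `Δ : A → A ⊗ A`. -/
def CState.conv {A : Type u} [CStarAlgebra A] (Δ : A →⋆ₐ[ℂ] MinTensor A A) (φ ψ : CState A) :
    CState A :=
  (φ.prod ψ).comp Δ

/-- A compact quantum group `G`, through its C*-algebra `C(G)`: a nonzero unital C*-algebra with a
unital `*`-homomorphism `Δ : C(G) → C(G) ⊗ C(G)` which is coassociative and satisfies the density
(cancellation) conditions. Coassociativity is tested on product states, which separate the points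
of `C(G) ⊗ C(G) ⊗ C(G)`: `(φ ⊗ ψ ⊗ χ)(Δ ⊗ id)Δ = (φ ⊗ ψ ⊗ χ)(id ⊗ Δ)Δ` for all states. -/
structure CompactQuantumGroup : Type (u + 1) where
  /-- The algebra `C(G)`. -/
  alg : Type u
  [cstar : CStarAlgebra alg]
  [nontrivial : Nontrivial alg]
  /-- The comultiplication. -/
  comul : alg →⋆ₐ[ℂ] MinTensor alg alg
  coassoc : ∀ φ ψ χ : CState alg,
    CState.conv comul (CState.conv comul φ ψ) χ = CState.conv comul φ (CState.conv comul ψ χ)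
  dense_left : Dense
    (Submodule.span ℂ {x | ∃ a b, x = comul a * MinTensor.tmul 1 b} : Set (MinTensor alg alg))
  dense_right : Dense
    (Submodule.span ℂ {x | ∃ a b, x = comul a * MinTensor.tmul b 1} : Set (MinTensor alg alg))

attribute [instance] CompactQuantumGroup.cstar CompactQuantumGroup.nontrivial

/-- A morphism of compact quantum groups `K → G`, through the corresponding unital
`*`-homomorphism `f : C(G) → C(K)` with `Δ_K ∘ f = (f ⊗ f) ∘ Δ_G`, the latter tested on product
states: `(φ ⊗ ψ) Δ_K f = (φ f ⊗ ψ f) Δ_G`. -/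
structure CQGHom (G K : CompactQuantumGroup.{u}) where
  toHom : G.alg →⋆ₐ[ℂ] K.alg
  map_comul : ∀ φ ψ : CState K.alg,
    (CState.conv K.comul φ ψ).comp toHom = CState.conv G.comul (φ.comp toHom) (ψ.comp toHom)

/-! ### The noncommutative manifold associated to a discrete group -/

section GroupAlgebra

variable {Γ : Type} [Group Γ]

/-- The involution of the group algebra `ℂΓ`: antilinear, with `g* = g⁻¹`. -/
instance : Star (MonoidAlgebra ℂ Γ) where
  star x := MonoidAlgebra.ofCoeff
    ((x.coeff.mapRange star (star_zero ℂ)).mapDomain (fun g => g⁻¹))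

lemma groupAlgebra_star_add (x y : MonoidAlgebra ℂ Γ) : star (x + y) = star x + star y := by
  change MonoidAlgebra.ofCoeff
    (((x.coeff + y.coeff).mapRange star (star_zero ℂ)).mapDomain (fun g => g⁻¹)) = _
  rw [Finsupp.mapRange_add star_add, Finsupp.mapDomain_add, MonoidAlgebra.ofCoeff_add]
  rfl

lemma groupAlgebra_star_single (g : Γ) (c : ℂ) :
    star (MonoidAlgebra.single g c) = MonoidAlgebra.single g⁻¹ (star c) := by
  simp only [star, MonoidAlgebra.coeff_single]
  rw [Finsupp.mapRange_single, Finsupp.mapDomain_single]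
  rfl

instance : StarRing (MonoidAlgebra ℂ Γ) where
  star_involutive x := by
    induction x using MonoidAlgebra.induction_linear with
    | zero => simp [star]
    | add x y hx hy => rw [groupAlgebra_star_add, groupAlgebra_star_add, hx, hy]
    | single g c => simp [groupAlgebra_star_single]
  star_mul x y := by
    induction x using MonoidAlgebra.induction_linear with
    | zero => simp [star]
    | add x x' hx hx' => rw [add_mul, groupAlgebra_star_add, groupAlgebra_star_add, hx, hx', mul_add]
    | single g c =>
      induction y using MonoidAlgebra.induction_linear with
      | zero => simp [star]
      | add x x' hx hx' =>
        rw [mul_add, groupAlgebra_star_add, groupAlgebra_star_add, hx, hx', add_mul]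
      | single h d =>
        simp [groupAlgebra_star_single, MonoidAlgebra.single_mul_single, mul_comm]
  star_add := groupAlgebra_star_add

instance : StarModule ℂ (MonoidAlgebra ℂ Γ) where
  star_smul c x := by
    induction x using MonoidAlgebra.induction_linear with
    | zero => simp [star]
    | add x y hx hy => rw [smul_add, groupAlgebra_star_add, groupAlgebra_star_add, hx, hy, smul_add]
    | single g d => simp [groupAlgebra_star_single]

/-- The length of `g` with respect to `S`: the least `r` such that `g` is a product of `r`
elements of `S` (for a generating set `S = S⁻¹`). -/
def wordLength (S : Set Γ) (g : Γ) : ℕ :=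
  sInf {r | ∃ w : List Γ, w.length = r ∧ (∀ x ∈ w, x ∈ S) ∧ w.prod = g}

/-- The coefficient functional `x ↦ x_g` on `ℂΓ`. For `g = 1` it is the standard trace. -/
def groupCoeff (g : Γ) : MonoidAlgebra ℂ Γ →ₗ[ℂ] ℂ where
  toFun x := x.coeff g
  map_add' _ _ := rfl
  map_smul' _ _ := rfl

/-- The Dirac operator `D δ_g = l(g) δ_g`, on the dense subspace `ℂΓ` of `ℓ²(Γ)`. (For finite `S`
the eigenspaces of `D` in `ℓ²(Γ)` are finite-dimensional and contained in `ℂΓ`.) -/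
def diracOp (S : Set Γ) : MonoidAlgebra ℂ Γ →ₗ[ℂ] MonoidAlgebra ℂ Γ :=
  (MonoidAlgebra.basis Γ ℂ).constr ℂ fun g => (wordLength S g : ℂ) • MonoidAlgebra.single g 1

/-- The functional `(x ↦ x_g) ⊗ id : ℂΓ ⊗ B → B`. -/
def tensorCoeff (B : Type u) [CStarAlgebra B] (g : Γ) : MonoidAlgebra ℂ Γ ⊗[ℂ] B →ₗ[ℂ] B :=
  (TensorProduct.lid ℂ B).toLinearMap ∘ₗ (groupCoeff g).rTensor B

/-- An isometric action of the compact quantum group `G` on the manifold `Γ̂`, where `Γ` is a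
discrete group with generating set `S`: an action on `C*(Γ)` which leaves invariant the eigenspaces
of `D` and the standard trace.

Since the eigenspaces `span {g | l(g) = r}` are invariant, the action restricts to a `*`-homomorphism
`α : ℂΓ → ℂΓ ⊗ C(G)` into the algebraic tensor product, and it is recovered from this restriction by
the universal property of `C*(Γ)`. The density condition "`α(C*(Γ)) (1 ⊗ C(G))` is total" becomes
the condition `total` on the dense subalgebra `ℂΓ`. -/
structure IsometricAction (S : Set Γ) (G : CompactQuantumGroup.{u}) where
  /-- The coaction map. -/
  coact : MonoidAlgebra ℂ Γ →⋆ₐ[ℂ] MonoidAlgebra ℂ Γ ⊗[ℂ] G.alg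
  /-- `(α ⊗ id) α = (id ⊗ Δ) α`, as maps to `ℂΓ ⊗ (C(G) ⊗ C(G))`. -/
  coassoc : ∀ x,
    (MinTensor.ofTensor.lTensor (MonoidAlgebra ℂ Γ))
      (TensorProduct.assoc ℂ (MonoidAlgebra ℂ Γ) G.alg G.alg
        ((coact.toAlgHom.toLinearMap.rTensor G.alg) (coact x))) =
    (G.comul.toAlgHom.toLinearMap.lTensor (MonoidAlgebra ℂ Γ)) (coact x)
  total : Submodule.span ℂ {y | ∃ x b, y = coact x * (1 ⊗ₜ[ℂ] b)} = ⊤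
  /-- `α(E) ⊆ E ⊗ C(G)` for each eigenspace `E` of `D`. -/
  map_eigenspace : ∀ (t : ℂ), ∀ x ∈ Module.End.eigenspace (diracOp S) t,
    coact x ∈ LinearMap.range
      ((Module.End.eigenspace (diracOp S) t).subtype.rTensor G.alg)
  /-- `(tr ⊗ id) α(x) = tr(x) 1`. -/
  map_trace : ∀ x, tensorCoeff G.alg 1 (coact x) = groupCoeff 1 x • (1 : G.alg)

/-- `G`, with the action `α`, is the quantum isometry group `G⁺(Γ̂)`: the universal compact quantum
group acting isometrically on `Γ̂`. Every isometric action `β` of any `K` comes from a unique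
morphism `K → G`. -/
def IsQuantumIsometryGroup (S : Set Γ) (G : CompactQuantumGroup.{u}) (α : IsometricAction S G) :
    Prop :=
  ∀ (K : CompactQuantumGroup.{u}) (β : IsometricAction S K),
    ∃! f : CQGHom G K, ∀ x,
      β.coact x = (f.toHom.toAlgHom.toLinearMap.lTensor (MonoidAlgebra ℂ Γ)) (α.coact x)

/-- The family `g_{i1} = g_i`, `g_{i2} = g_i⁻¹` associated to `g_1, …, g_n`; the index `a ∈ {1, 2}`
is written as `0` or `1` in `Fin 2`. -/
def symmFamily {n : ℕ} (g : Fin n → Γ) (I : Fin n × Fin 2) : Γ :=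
  if I.2 = 0 then g I.1 else (g I.1)⁻¹

/-- The matrix `u` with `α(g_{ia}) = ∑_{jb} g_{jb} ⊗ u_{jb,ia}`, for the action `α` on `Γ̂`, where
`Γ` has the generating set `S = {g_{ia}}`. -/
def IsometricAction.fundamental {n : ℕ} {g : Fin n → Γ} {G : CompactQuantumGroup.{u}}
    (α : IsometricAction (Set.range (symmFamily g)) G) :
    Matrix (Fin n × Fin 2) (Fin n × Fin 2) G.alg :=
  fun J I => tensorCoeff G.alg (symmFamily g J)
    (α.coact (MonoidAlgebra.single (symmFamily g I) 1))

end GroupAlgebra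

/-- The standard generators of the free group `F_n`. -/
def freeGen (n : ℕ) : Fin n → FreeGroup (Fin n) := FreeGroup.of

/-- The free product `ℤ_s * ⋯ * ℤ_s` of `n` copies of the cyclic group of order `s`. -/
abbrev CyclicFreePower (s n : ℕ) : Type := Monoid.CoprodI fun _ : Fin n => Multiplicative (ZMod s)

/-- The standard generators of `ℤ_s^{*n}`. -/
def cyclicGen (s n : ℕ) : Fin n → CyclicFreePower s n := fun i =>
  Monoid.CoprodI.of (i := i) (Multiplicative.ofAdd (1 : ZMod s))

/-! ### The relation `ξ ∈ Fix(u^{⊗ s})` -/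

section Fix

variable {ι : Type} [Fintype ι] [DecidableEq ι] {A : Type u} [CStarAlgebra A]

/-- The matrix of `u^{⊗ s}` on `(ℂ^ι)^{⊗ s}`, in the basis `e_{J_1} ⊗ ⋯ ⊗ e_{J_s}`. -/
def tensorPower (u : Matrix ι ι A) (s : ℕ) : Matrix (Fin s → ι) (Fin s → ι) A :=
  fun J K => (List.ofFn fun r => u (J r) (K r)).prod

/-- The coordinates of `ξ = ∑_I e_I^{⊗ s}`. -/
def xiVec (ι : Type) [Fintype ι] [DecidableEq ι] (s : ℕ) (J : Fin s → ι) : ℂ :=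
  ∑ I : ι, ∏ r : Fin s, if J r = I then 1 else 0

/-- The coordinates of `u^{⊗ s}(ξ ⊗ 1) - ξ ⊗ 1`: the relations expressing `ξ ∈ Fix(u^{⊗ s})`. -/
def fixRelation (u : Matrix ι ι A) (s : ℕ) (J : Fin s → ι) : A :=
  (tensorPower u s).mulVec (fun K => algebraMap ℂ A (xiVec ι s K)) J -
    algebraMap ℂ A (xiVec ι s J)

end Fix

/-- The morphism `K → G` given by `p : C(G) → C(K)` makes `K` the quantum subgroup of `G` presented
by the relations `r = 0`, `r ∈ R`: `p` is surjective, and `C(K)` is the universal C*-algebra obtained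
from `C(G)` by imposing these relations. -/
structure IsPresentedSubgroup {G K : CompactQuantumGroup.{u}} (p : CQGHom G K) (R : Set G.alg) :
    Prop where
  surjective : Function.Surjective p.toHom
  relations : ∀ r ∈ R, p.toHom r = 0
  universal : ∀ (B : Type u) [CStarAlgebra B] (f : G.alg →⋆ₐ[ℂ] B), (∀ r ∈ R, f r = 0) →
    ∃! f' : K.alg →⋆ₐ[ℂ] B, f'.comp p.toHom = f

end

/-! The eigenspace of `D` for the eigenvalue 1 is the span of the generators, so an isometric action
is determined by a matrix `v` over `C(G)`. The matrices that occur are described by purely algebraic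
conditions (`IsIsometryMatrix`): words representing 1 go to 1, other words go to trace 0, the
entries respect inversion, and the rows are orthonormal. These conditions bound the entries, so a
universal C*-algebra for them exists (`exists_isUniversalMatrix`). They are stable under the product
of matrices with entries in `B ⊗ B'`, which yields the comultiplication. Hence the quantum isometry
group exists and is characterized by having the universal matrix
(`IsSymmGen.exists_quantumIsometryGroup`, `IsQuantumIsometryGroup.isUniversalMatrix`).

It remains to compare the matrices for the two groups. In both, a nonempty word representing 1
contains a relator, and every relator other than a cancellation has length at least 5. Hence a
product of two generators, if not 1, determines both factors (`eq_of_mul_eq_mul`). Comparing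
coefficients in `α(g)α(g⁻¹) = 1` then gives the "cubic" relations: on each row and column the
entries are partial isometries with orthogonal supports and ranges
(`IsCubicMatrix.of_isIsometryMatrix`). For the free group these relations are also sufficient.

For `ℤ_s^{*n}` the trace of `α(g)^s = 1` says that the `s`-th powers on each column sum up to 1.
With the orthogonality this forces `a^s = aa* = a*a` for every entry `a` (`pow_eq_of_sum_pow`).
Normal entries on one row or column then have zero products, and `ξ ∈ Fix(u^{⊗ s})` follows.
Conversely, the coordinates of this relation at constant indices give row sums of `s`-th powers
equal to 1, hence the same normality, hence the relations of the cyclic factors. So matrices for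
`ℤ_s^{*n}` are exactly the matrices for `F_n` satisfying the relation, and the theorem is a
comparison of universal properties. -/

set_option linter.unusedSectionVars false

noncomputable section

/-! ### States and elementary tensors in the minimal tensor product -/

section TensorStates

open UniformSpace

namespace CState

variable {A : Type u} [CStarAlgebra A]

@[ext]
lemma ext {φ ψ : CState A} (h : ∀ a, φ.toLin a = ψ.toLin a) : φ = ψ := by
  cases φ; cases ψ
  congr
  exact LinearMap.ext h

lemma inner_vec (φ : CState A) (a : A) : ⟪φ.vec, φ.rep a φ.vec⟫_ℂ = φ.toLin a := by
  let _ := CStarAlgebra.spectralOrder A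
  have _ := CStarAlgebra.spectralOrderedRing A
  change ⟪((φ.toPositive.toPreGNS 1 : φ.toPositive.PreGNS) : φ.toPositive.GNS),
    φ.toPositive.gnsNonUnitalStarAlgHom a
      ((φ.toPositive.toPreGNS 1 : φ.toPositive.PreGNS) : φ.toPositive.GNS)⟫_ℂ = _
  rw [PositiveLinearMap.gnsNonUnitalStarAlgHom_apply_coe, Completion.inner_coe,
    PositiveLinearMap.preGNS_inner_def]
  simp
  rfl

/-- In its GNS representation, which is contractive, a state is a vector state. -/
lemma continuous_toLin (φ : CState A) : Continuous φ.toLin := by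
  have h : Continuous φ.rep := 
    AddMonoidHomClass.continuous_of_bound φ.rep 1 fun a => by
      simpa using NonUnitalStarAlgHom.norm_apply_le φ.rep a
  have : (φ.toLin : A → ℂ) = fun a => ⟪φ.vec, φ.rep a φ.vec⟫_ℂ := by
    ext a; rw [inner_vec]
  rw [this]
  fun_prop

end CState

namespace MinTensor

variable {A B : Type u} [CStarAlgebra A] [CStarAlgebra B]

lemma tmul_mul_tmul (a a' : A) (b b' : B) : tmul a b * tmul a' b' = tmul (a * a') (b * b') :=
  ext_component fun p => gnsTensorOp_ext fun x y => by
    rw [component_mul, mul_apply_eq_comp]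
    simp only [component_tmul_apply, map_mul, mul_apply_eq_comp]

lemma tmul_one_one : tmul (1 : A) (1 : B) = 1 :=
  ext_component fun p => gnsTensorOp_ext fun x y => by
    rw [component_one]
    simp only [component_tmul_apply, map_one, one_apply_eq_self]

lemma star_tmul (a : A) (b : B) : star (tmul a b) = tmul (star a) (star b) :=
  ext_component fun p => by
    rw [component_star, ContinuousLinearMap.star_eq_adjoint]
    symm
    rw [ContinuousLinearMap.eq_adjoint_iff]
    intro x y
    induction x, y using Completion.induction_on₂ with
    | hp => apply isClosed_eq <;> fun_prop
    | ih x y =>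
      induction x using TensorProduct.induction_on with
      | zero => rw [Completion.coe_zero, map_zero, inner_zero_left, inner_zero_left]
      | add x x' hx hx' =>
        rw [Completion.coe_add, map_add, inner_add_left, inner_add_left, hx, hx']
      | tmul x x' =>
        induction y using TensorProduct.induction_on with
        | zero => rw [Completion.coe_zero, map_zero, inner_zero_right, inner_zero_right]
        | add y y' hy hy' =>
          rw [Completion.coe_add, map_add, inner_add_right, inner_add_right, hy, hy']
        | tmul y y' =>
          simp only [component_tmul_apply, Completion.inner_coe, TensorProduct.inner_tmul,
            map_star, ContinuousLinearMap.star_eq_adjoint, ContinuousLinearMap.adjoint_inner_left]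

lemma ofTensor_tmul (a : A) (b : B) : ofTensor (a ⊗ₜ[ℂ] b) = tmul a b := rfl

lemma tmul_sum {κ : Type*} (s : Finset κ) (a : A) (b : κ → B) :
    tmul a (∑ k ∈ s, b k) = ∑ k ∈ s, tmul a (b k) := by
  simp only [← ofTensor_tmul, TensorProduct.tmul_sum, map_sum]

lemma sum_tmul {κ : Type*} (s : Finset κ) (a : κ → A) (b : B) :
    tmul (∑ k ∈ s, a k) b = ∑ k ∈ s, tmul (a k) b := by
  simp only [← ofTensor_tmul, TensorProduct.sum_tmul, map_sum]

lemma tmul_zero (a : A) : tmul a (0 : B) = 0 := by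
  rw [← ofTensor_tmul, TensorProduct.tmul_zero, map_zero]

lemma zero_tmul (b : B) : tmul (0 : A) b = 0 := by
  rw [← ofTensor_tmul, TensorProduct.zero_tmul, map_zero]

lemma norm_tmul_le (a : A) (b : B) : ‖tmul a b‖ ≤ ‖a‖ * ‖b‖ :=
  lp.norm_le_of_forall_le (f := gnsTmul a b) (by positivity) fun p => norm_gnsTensorOp_le a b p

lemma continuous_tmul_left (b : B) : Continuous fun a : A => tmul a b :=
  (LinearMap.mkContinuous (ofTensor ∘ₗ (TensorProduct.mk ℂ A B).flip b) ‖b‖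
    fun a => (norm_tmul_le a b).trans_eq (mul_comm _ _)).continuous

lemma continuous_tmul_right (a : A) : Continuous fun b : B => tmul a b :=
  (LinearMap.mkContinuous (ofTensor ∘ₗ (TensorProduct.mk ℂ A B) a) ‖a‖
    fun b => (norm_tmul_le a b)).continuous

/-- The elementary tensors span a dense subspace. -/
lemma dense_span_tmul :
    Dense (Submodule.span ℂ {x : MinTensor A B | ∃ a b, x = tmul a b} : Set (MinTensor A B)) := by
  intro x
  obtain ⟨x, hx⟩ := x
  -- The span of elementary tensors is already closed under products and adjoints, so the generated
  -- `*`-algebra is no larger than this span.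
  have key : ∀ y ∈ StarAlgebra.adjoin ℂ {x : GNSTensorProd A B | ∃ a b, x = gnsTmul a b},
      ∃ z ∈ Submodule.span ℂ {x | ∃ a b, x = tmul (A := A) (B := B) a b}, z.1 = y := by
    intro y hy
    induction hy using StarAlgebra.adjoin_induction with
    | mem x h =>
      obtain ⟨a, b, rfl⟩ := h
      exact ⟨tmul a b, Submodule.subset_span ⟨a, b, rfl⟩, rfl⟩
    | algebraMap r =>
      refine ⟨algebraMap ℂ _ r, ?_, rfl⟩
      rw [Algebra.algebraMap_eq_smul_one]
      exact Submodule.smul_mem _ _ (Submodule.subset_span ⟨1, 1, tmul_one_one.symm⟩)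
    | add x y _ _ hx hy =>
      obtain ⟨x, hx, rfl⟩ := hx
      obtain ⟨y, hy, rfl⟩ := hy
      exact ⟨x + y, add_mem hx hy, rfl⟩
    | mul x y _ _ hx hy =>
      obtain ⟨x, hx, rfl⟩ := hx
      obtain ⟨y, hy, rfl⟩ := hy
      refine ⟨x * y, ?_, rfl⟩
      have := Submodule.mul_mem_mul hx hy
      rw [Submodule.span_mul_span] at this
      refine Submodule.span_mono ?_ this
      rintro _ ⟨_, ⟨a, b, rfl⟩, _, ⟨a', b', rfl⟩, rfl⟩
      exact ⟨_, _, tmul_mul_tmul ..⟩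
    | star x hmem hx =>
      obtain ⟨x, hx, rfl⟩ := hx
      clear hmem
      refine ⟨star x, ?_, rfl⟩
      induction hx using Submodule.span_induction with
      | mem x h =>
        obtain ⟨a, b, rfl⟩ := h
        exact Submodule.subset_span ⟨_, _, star_tmul a b⟩
      | zero => simp
      | add x y _ _ hx hy => rw [star_add]; exact add_mem hx hy
      | smul c x _ hx => rw [star_smul]; exact Submodule.smul_mem _ _ hx
  refine (closure_subtype (p := fun x => x ∈ minTensorSubalgebra A B)).2 (closure_mono ?_ hx)
  intro y hy
  obtain ⟨z, hz, rfl⟩ := key y hy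
  exact ⟨z, hz, rfl⟩

end MinTensor

variable {A B : Type u} [CStarAlgebra A] [CStarAlgebra B]

lemma CState.prod_tmul (φ : CState A) (ψ : CState B) (a : A) (b : B) :
    (φ.prod ψ).toLin (MinTensor.tmul a b) = φ.toLin a * ψ.toLin b := by
  change ⟪gnsTensorVec (φ, ψ), (MinTensor.tmul a b).component (φ, ψ) (gnsTensorVec (φ, ψ))⟫_ℂ = _
  rw [gnsTensorVec, MinTensor.component_tmul_apply, Completion.inner_coe, TensorProduct.inner_tmul,
    CState.inner_vec, CState.inner_vec]

end TensorStates

/-! ### Ranges, positivity and extension of homomorphisms of C*-algebras -/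

section CStarLemmas

variable {A B : Type*} [CStarAlgebra A] [CStarAlgebra B]

lemma StarAlgHom.norm_map_le (f : A →⋆ₐ[ℂ] B) (a : A) : ‖f a‖ ≤ ‖a‖ :=
  NonUnitalStarAlgHom.norm_apply_le f a

lemma StarAlgHom.continuous_of_cstar (f : A →⋆ₐ[ℂ] B) : Continuous f :=
  AddMonoidHomClass.continuous_of_bound f 1 fun a => by simpa using f.norm_map_le a

/-- Functional calculus truncates `a` to the interval `[-‖f a‖, ‖f a‖]`. It commutes with `f`, and
the truncation is the identity on the spectrum of `f a`. -/
lemma StarAlgHom.exists_isSelfAdjoint_lift (f : A →⋆ₐ[ℂ] B) {a : A} (ha : IsSelfAdjoint a) :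
    ∃ a', f a' = f a ∧ ‖a'‖ ≤ ‖f a‖ := by
  rcases subsingleton_or_nontrivial B with hB | hB
  · exact ⟨0, Subsingleton.elim _ _, by simp⟩
  let h : ℝ → ℝ := fun t => max (-‖f a‖) (min t ‖f a‖)
  have hc : Continuous h := by fun_prop
  have hb : IsSelfAdjoint (f a) := ha.map f
  refine ⟨cfc h a, ?_, ?_⟩
  · have hm : f (cfc h a) = cfc h (f a) :=
      StarAlgHomClass.map_cfc (S := ℂ) f h a hc.continuousOn f.continuous_of_cstar ha hb
    rw [hm]
    conv_rhs => rw [← cfc_id ℝ (f a)]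
    refine cfc_congr fun t ht => ?_
    have := abs_le.1 (spectrum.norm_le_norm_of_mem ht)
    simp only [h, id, min_eq_left this.2, max_eq_right this.1]
  · refine norm_cfc_le (norm_nonneg _) fun t _ => ?_
    rw [Real.norm_eq_abs, abs_le]
    have := norm_nonneg (f a)
    exact ⟨le_max_left _ _, max_le (by linarith) (min_le_right _ _)⟩

/-- Lift the real and imaginary parts separately; the two norms add up to the factor 2. -/
lemma StarAlgHom.exists_lift (f : A →⋆ₐ[ℂ] B) (a : A) :
    ∃ a', f a' = f a ∧ ‖a'‖ ≤ 2 * ‖f a‖ := by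
  obtain ⟨x, hx, hx'⟩ := f.exists_isSelfAdjoint_lift (realPart a).2
  obtain ⟨y, hy, hy'⟩ := f.exists_isSelfAdjoint_lift (imaginaryPart a).2
  have hr : ‖f (realPart a : A)‖ ≤ ‖f a‖ := by
    rw [map_realPart]; exact realPart.norm_le (f a)
  have hi : ‖f (imaginaryPart a : A)‖ ≤ ‖f a‖ := by
    rw [map_imaginaryPart]; exact imaginaryPart.norm_le (f a)
  refine ⟨x + Complex.I • y, ?_, ?_⟩
  · rw [map_add, map_smul, hx, hy, ← map_smul, ← map_add, realPart_add_I_smul_imaginaryPart]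
  · refine (norm_add_le _ _).trans ?_
    rw [norm_smul, Complex.norm_I]
    linarith

/-- A `*`-homomorphism of C*-algebras with dense range is surjective. -/
lemma StarAlgHom.surjective_of_denseRange (f : A →⋆ₐ[ℂ] B) (hf : DenseRange f) :
    Function.Surjective f := by
  let F : NormedAddGroupHom A B :=
    AddMonoidHom.mkNormedAddGroupHom (f : A →+ B) 1 fun a => by simpa using f.norm_map_le a
  have h : F.SurjectiveOnWith F.range 2 := by
    rintro _ ⟨a, rfl⟩
    exact f.exists_lift a
  -- Lifts with a uniform norm bound let one sum a series of successive approximations, so the range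
  -- is closed.
  have := controlled_closure_of_complete two_pos one_pos h
  intro b
  obtain ⟨a, ha, -⟩ := this b (by
    change b ∈ closure (F.range : Set B)
    convert hf b
    ext; rfl)
  exact ⟨a, ha⟩

/-- Projections which sum up to `1` are pairwise orthogonal. -/
lemma projection_mul_eq_zero {κ : Type*} [Fintype κ] [DecidableEq κ] {p : κ → A}
    (hs : ∀ k, star (p k) = p k) (hp : ∀ k, p k * p k = p k) (h : ∑ k, p k = 1) {i j : κ}
    (hij : i ≠ j) : p i * p j = 0 := by
  let _ := CStarAlgebra.spectralOrder A
  have _ := CStarAlgebra.spectralOrderedRing A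
  -- Compressing `∑ p_k = 1` by `p_j` gives `p_j`, which is already the term `k = j`; the remaining
  -- terms are positive with sum zero.
  have h1 : ∑ k ∈ Finset.univ.erase j, star (p k * p j) * (p k * p j) = 0 := by
    have h2 : ∑ k, star (p k * p j) * (p k * p j) = p j := by
      have : ∀ k, star (p k * p j) * (p k * p j) = p j * p k * p j := fun k => by
        rw [star_mul, hs, hs, mul_assoc, ← mul_assoc (p k), hp, mul_assoc]
      simp only [this, ← Finset.sum_mul, ← Finset.mul_sum, h, mul_one, hp]
    have h3 := Finset.add_sum_erase Finset.univ
      (fun k => star (p k * p j) * (p k * p j)) (Finset.mem_univ j)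
    simp only [h2, hp, hs] at h3
    simpa using h3
  rw [Finset.sum_eq_zero_iff_of_nonneg fun k _ => star_mul_self_nonneg _] at h1
  exact CStarRing.star_mul_self_eq_zero_iff _ |>.1 (h1 i (by simp [hij]))

/-- Each `a_k a_k*` is dominated by the sum. This uniform bound on the entries makes the universal
C*-algebra of isometry matrices possible. -/
lemma norm_le_one_of_sum_mul_star {κ : Type*} [Fintype κ] {a : κ → A}
    (h : ∑ k, a k * star (a k) = 1) (i : κ) : ‖a i‖ ≤ 1 := by
  let _ := CStarAlgebra.spectralOrder A
  have _ := CStarAlgebra.spectralOrderedRing A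
  rcases subsingleton_or_nontrivial A with hA | hA
  · simp [Subsingleton.elim (a i) 0]
  have h1 : a i * star (a i) ≤ 1 := by
    rw [← h]
    exact Finset.single_le_sum (f := fun k => a k * star (a k))
      (fun k _ => mul_star_self_nonneg _) (Finset.mem_univ i)
  have h2 := CStarAlgebra.norm_le_norm_of_nonneg_of_le (mul_star_self_nonneg _) h1
  rw [CStarRing.norm_self_mul_star, CStarRing.norm_one] at h2
  nlinarith [norm_nonneg (a i)]

/-- Extension of a contractive algebra homomorphism, given on a dense `*`-closed subalgebra, to a
`*`-homomorphism. -/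
lemma exists_starAlgHom_of_norm_le {F : Type*} [Ring F] [Algebra ℂ F] (e : F →ₐ[ℂ] A)
    (k : F →ₐ[ℂ] B) (he : DenseRange e) (hn : ∀ x, ‖k x‖ ≤ ‖e x‖)
    (hs : ∀ x, ∃ y, star (e x) = e y ∧ star (k x) = k y) :
    ∃ f : A →⋆ₐ[ℂ] B, ∀ x, f (e x) = k x := by
  -- The norm inequality makes `k` factor through the range of `e`, so no injectivity of `e` is
  -- needed.
  let g : A →L[ℂ] B := k.toLinearMap.extendOfNorm e.toLinearMap
  have hg : ∀ x, g (e x) = k x := fun x =>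
    LinearMap.extendOfNorm_eq (f := k.toLinearMap) (e := e.toLinearMap) he
      ⟨1, fun x => by simpa using hn x⟩ x
  have h1 : g 1 = 1 := by rw [← map_one e, hg, map_one]
  refine ⟨{ toFun := g
            map_one' := h1
            map_mul' := fun x y => ?_
            map_zero' := map_zero g
            map_add' := map_add g
            commutes' := fun r => ?_
            map_star' := fun x => ?_ }, hg⟩
  · refine he.induction_on₂ (p := fun x y => g (x * y) = g x * g y) ?_ (fun a b => ?_) x y
    · exact isClosed_eq (by fun_prop) (by fun_prop)
    · rw [← map_mul, hg, hg, hg, map_mul]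
  · rw [Algebra.algebraMap_eq_smul_one, Algebra.algebraMap_eq_smul_one, map_smul, h1]
  · refine he.induction_on (p := fun x => g (star x) = star (g x)) x ?_ fun a => ?_
    · exact isClosed_eq (by fun_prop) (by fun_prop)
    · obtain ⟨b, hb, hb'⟩ := hs a
      rw [hb, hg, hg, hb']

end CStarLemmas

/-! ### Coefficients of elements of `ℂΓ ⊗ B` -/

section TensorCoeff

variable {Γ : Type} [Group Γ] {B B' : Type u} [CStarAlgebra B] [CStarAlgebra B']

lemma groupCoeff_single [DecidableEq Γ] (g h : Γ) (c : ℂ) :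
    groupCoeff g (MonoidAlgebra.single h c) = if h = g then c else 0 := by
  classical
  change (MonoidAlgebra.single h c).coeff g = _
  rw [MonoidAlgebra.coeff_single, Finsupp.single_apply]

lemma tensorCoeff_tmul (g : Γ) (x : MonoidAlgebra ℂ Γ) (b : B) :
    tensorCoeff B g (x ⊗ₜ b) = groupCoeff g x • b := by
  simp [tensorCoeff]

lemma tensorCoeff_single_tmul [DecidableEq Γ] (g h : Γ) (b : B) :
    tensorCoeff B g (MonoidAlgebra.single h 1 ⊗ₜ b) = if h = g then b else 0 := by
  rw [tensorCoeff_tmul, groupCoeff_single]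
  split_ifs <;> simp

lemma tensorCoeff_ext {y z : MonoidAlgebra ℂ Γ ⊗[ℂ] B}
    (h : ∀ g, tensorCoeff B g y = tensorCoeff B g z) : y = z := by
  classical
  let E := TensorProduct.equivFinsuppOfBasisLeft (N := B) (MonoidAlgebra.basis Γ ℂ)
  have key : ∀ (g : Γ) (y : MonoidAlgebra ℂ Γ ⊗[ℂ] B), E y g = tensorCoeff B g y := fun g y => by
    induction y using TensorProduct.induction_on with
    | zero => simp
    | add x y hx hy => rw [map_add, Finsupp.add_apply, hx, hy, map_add]
    | tmul x b =>
      rw [TensorProduct.equivFinsuppOfBasisLeft_apply_tmul_apply, tensorCoeff_tmul]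
      rfl
  refine E.injective (Finsupp.ext fun g => ?_)
  rw [key, key, h]

/-- The homomorphism `id ⊗ f : ℂΓ ⊗ B → ℂΓ ⊗ B'`. -/
def mapCoeff (Γ : Type) [Group Γ] (f : B →⋆ₐ[ℂ] B') :
    MonoidAlgebra ℂ Γ ⊗[ℂ] B →ₐ[ℂ] MonoidAlgebra ℂ Γ ⊗[ℂ] B' :=
  Algebra.TensorProduct.map (AlgHom.id ℂ _) f.toAlgHom

lemma mapCoeff_tmul (f : B →⋆ₐ[ℂ] B') (x : MonoidAlgebra ℂ Γ) (b : B) :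
    mapCoeff Γ f (x ⊗ₜ b) = x ⊗ₜ f b := rfl

lemma mapCoeff_eq_lTensor (f : B →⋆ₐ[ℂ] B') (y : MonoidAlgebra ℂ Γ ⊗[ℂ] B) :
    mapCoeff Γ f y = f.toAlgHom.toLinearMap.lTensor (MonoidAlgebra ℂ Γ) y := rfl

lemma tensorCoeff_mapCoeff (f : B →⋆ₐ[ℂ] B') (g : Γ) (y : MonoidAlgebra ℂ Γ ⊗[ℂ] B) :
    tensorCoeff B' g (mapCoeff Γ f y) = f (tensorCoeff B g y) := by
  induction y using TensorProduct.induction_on with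
  | zero => simp
  | add x y hx hy => simp only [map_add, hx, hy]
  | tmul x b => rw [mapCoeff_tmul, tensorCoeff_tmul, tensorCoeff_tmul, map_smul]

lemma mapCoeff_star (f : B →⋆ₐ[ℂ] B') (y : MonoidAlgebra ℂ Γ ⊗[ℂ] B) :
    mapCoeff Γ f (star y) = star (mapCoeff Γ f y) := by
  induction y using TensorProduct.induction_on with
  | zero => simp
  | add x y hx hy => simp only [map_add, star_add, hx, hy]
  | tmul x b =>
    rw [TensorProduct.star_tmul, mapCoeff_tmul, mapCoeff_tmul, TensorProduct.star_tmul, map_star]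

lemma tensorCoeff_mul_tmul (g : Γ) (y : MonoidAlgebra ℂ Γ ⊗[ℂ] B) (b : B) :
    tensorCoeff B g (y * (1 ⊗ₜ b)) = tensorCoeff B g y * b := by
  induction y using TensorProduct.induction_on with
  | zero => simp
  | add x y hx hy => simp only [map_add, add_mul, hx, hy]
  | tmul x c =>
    rw [Algebra.TensorProduct.tmul_mul_tmul, mul_one, tensorCoeff_tmul, tensorCoeff_tmul,
      smul_mul_assoc]

lemma tensorCoeff_tmul_mul (g : Γ) (y : MonoidAlgebra ℂ Γ ⊗[ℂ] B) (b : B) :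
    tensorCoeff B g ((1 ⊗ₜ b) * y) = b * tensorCoeff B g y := by
  induction y using TensorProduct.induction_on with
  | zero => simp
  | add x y hx hy => simp only [map_add, mul_add, hx, hy]
  | tmul x c =>
    rw [Algebra.TensorProduct.tmul_mul_tmul, one_mul, tensorCoeff_tmul, tensorCoeff_tmul,
      mul_smul_comm]

/-- Translation by `g⁻¹` turns any coefficient into a trace, to which trace invariance applies. -/
lemma tensorCoeff_eq_single_mul (g : Γ) (y : MonoidAlgebra ℂ Γ ⊗[ℂ] B) :
    tensorCoeff B g y = tensorCoeff B 1 ((MonoidAlgebra.single g⁻¹ 1 ⊗ₜ 1) * y) := by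
  classical
  induction y using TensorProduct.induction_on with
  | zero => simp
  | add x y hx hy => simp only [map_add, mul_add, hx, hy]
  | tmul x c =>
    induction x using MonoidAlgebra.induction_linear with
    | zero => simp
    | add x y hx hy => simp only [map_add, mul_add, TensorProduct.add_tmul, hx, hy]
    | single h d =>
      rw [Algebra.TensorProduct.tmul_mul_tmul, MonoidAlgebra.single_mul_single, tensorCoeff_tmul,
        tensorCoeff_tmul, groupCoeff_single, groupCoeff_single, one_mul, one_mul]
      simp only [inv_mul_eq_one, eq_comm]

end TensorCoeff

/-! ### Words in the generators and tensor powers of a matrix -/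

section Words

variable {Γ : Type} [Group Γ] {ι : Type} [Fintype ι] [DecidableEq ι] {B B' : Type u}
  [CStarAlgebra B] [CStarAlgebra B']

lemma tensorPower_zero (v : Matrix ι ι B) (J K : Fin 0 → ι) : tensorPower v 0 J K = 1 := by
  simp [tensorPower]

lemma tensorPower_cons (v : Matrix ι ι B) {r : ℕ} (j k : ι) (J K : Fin r → ι) :
    tensorPower v (r + 1) (Fin.cons j J) (Fin.cons k K) = v j k * tensorPower v r J K := by
  simp [tensorPower, List.ofFn_succ]

lemma tensorPower_transpose (v : Matrix ι ι B) {r : ℕ} (J K : Fin r → ι) :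
    tensorPower v.transpose r J K = tensorPower v r K J := rfl

lemma map_tensorPower (f : B →⋆ₐ[ℂ] B') (v : Matrix ι ι B) {r : ℕ} (J K : Fin r → ι) :
    f (tensorPower v r J K) = tensorPower (v.map f) r J K := by
  simp [tensorPower, map_list_prod, List.map_ofFn, Function.comp_def]

lemma sum_fin_succ {M : Type*} [AddCommMonoid M] {r : ℕ} (f : (Fin (r + 1) → ι) → M) :
    ∑ J, f J = ∑ j, ∑ J, f (Fin.cons j J) := by
  rw [← Fintype.sum_prod_type']
  exact (Fintype.sum_equiv (Fin.consEquiv fun _ => ι) _ _ fun _ => rfl).symm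

/-- If the rows of `v` are orthonormal, so are the rows of its tensor powers. -/
lemma tensorPower_row {v : Matrix ι ι B}
    (hv : ∀ K L, ∑ I, v K I * star (v L I) = if K = L then 1 else 0) {r : ℕ} (K L : Fin r → ι) :
    ∑ I, tensorPower v r K I * star (tensorPower v r L I) = if K = L then 1 else 0 := by
  induction r with
  | zero => simp [tensorPower_zero, Subsingleton.elim K L]
  | succ r ih =>
    obtain ⟨k, K, rfl⟩ : ∃ a A, Fin.cons a A = K := ⟨K 0, Fin.tail K, Fin.cons_self_tail K⟩
    obtain ⟨l, L, rfl⟩ : ∃ a A, Fin.cons a A = L := ⟨L 0, Fin.tail L, Fin.cons_self_tail L⟩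
    have h : ∀ i, ∑ I, tensorPower v (r + 1) (Fin.cons k K) (Fin.cons i I) *
        star (tensorPower v (r + 1) (Fin.cons l L) (Fin.cons i I)) =
        if K = L then v k i * star (v l i) else 0 := fun i => by
      simp only [tensorPower_cons, star_mul]
      have : ∀ I, v k i * tensorPower v r K I * (star (tensorPower v r L I) * star (v l i)) =
        v k i * (tensorPower v r K I * star (tensorPower v r L I)) * star (v l i) := fun I => by
          simp only [mul_assoc]
      simp only [this, ← Finset.sum_mul, ← Finset.mul_sum, ih]
      split_ifs <;> simp
    rw [sum_fin_succ]
    simp only [h, Fin.cons_inj]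
    by_cases hKL : K = L <;> simp [hKL, hv]

/-- The group element `e_{J_1} ⋯ e_{J_r}`. -/
def wordProd (e : ι → Γ) {r : ℕ} (J : Fin r → ι) : Γ := (List.ofFn fun k => e (J k)).prod

lemma wordProd_cons (e : ι → Γ) {r : ℕ} (j : ι) (J : Fin r → ι) :
    wordProd e (Fin.cons j J : Fin (r + 1) → ι) = e j * wordProd e J := by
  simp [wordProd, List.ofFn_succ]

/-- The element `∑_J e_J ⊗ v_{JI}` of `ℂΓ ⊗ B`. -/
def coactGen (e : ι → Γ) (v : Matrix ι ι B) (I : ι) : MonoidAlgebra ℂ Γ ⊗[ℂ] B :=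
  ∑ J, MonoidAlgebra.single (e J) 1 ⊗ₜ v J I

/-- The sum is indexed by words, not by group elements: several `J` may contribute to the same
coefficient. Controlling this is the main issue later. -/
lemma prod_coactGen (e : ι → Γ) (v : Matrix ι ι B) {r : ℕ} (I : Fin r → ι) :
    (List.ofFn fun k => coactGen e v (I k)).prod =
      ∑ J : Fin r → ι, MonoidAlgebra.single (wordProd e J) 1 ⊗ₜ tensorPower v r J I := by
  induction r with
  | zero => simp [tensorPower_zero, wordProd, Algebra.TensorProduct.one_def, MonoidAlgebra.one_def]
  | succ r ih =>
    obtain ⟨i, I, rfl⟩ : ∃ a A, Fin.cons a A = I := ⟨I 0, Fin.tail I, Fin.cons_self_tail I⟩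
    rw [List.ofFn_succ, List.prod_cons, sum_fin_succ]
    simp only [Fin.cons_zero, Fin.cons_succ, ih, tensorPower_cons, wordProd_cons]
    rw [coactGen, Finset.sum_mul_sum]
    simp only [Algebra.TensorProduct.tmul_mul_tmul, MonoidAlgebra.single_mul_single, mul_one]

lemma mapCoeff_coactGen (f : B →⋆ₐ[ℂ] B') (e : ι → Γ) (v : Matrix ι ι B) (I : ι) :
    mapCoeff Γ f (coactGen e v I) = coactGen e (v.map f) I := by
  simp [coactGen, mapCoeff_tmul]

lemma mapCoeff_prod_coactGen (f : B →⋆ₐ[ℂ] B') (e : ι → Γ) (v : Matrix ι ι B) (L : List ι) :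
    mapCoeff Γ f (L.map (coactGen e v)).prod = (L.map (coactGen e (v.map f))).prod := by
  simp [map_list_prod, Function.comp_def, mapCoeff_coactGen]

lemma tensorCoeff_coactGen {e : ι → Γ} (he : Function.Injective e) (v : Matrix ι ι B) (J I : ι) :
    tensorCoeff B (e J) (coactGen e v I) = v J I := by
  classical
  simp [coactGen, tensorCoeff_single_tmul, he.eq_iff]

end Words

/-! ### Isometry matrices, their coactions and their products -/

section IsometryMatrix

variable {Γ : Type} [Group Γ] {ι : Type} [Fintype ι] [DecidableEq ι] {B B' : Type u}
  [CStarAlgebra B] [CStarAlgebra B']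

/-- `e` is an injective family generating `Γ`, without the unit and closed under inversion:
`e (bar I) = (e I)⁻¹`. -/
structure IsSymmGen (e : ι → Γ) (bar : ι → ι) : Prop where
  bar_bar : ∀ I, bar (bar I) = I
  inv : ∀ I, e (bar I) = (e I)⁻¹
  inj : Function.Injective e
  gen : ∀ g, ∃ L : List ι, (L.map e).prod = g
  ne_one : ∀ I, e I ≠ 1

/-- The conditions on a matrix `v` over `B` under which `e_I ↦ ∑_J e_J ⊗ v_{JI}` defines a trace
preserving `*`-homomorphism `ℂΓ → ℂΓ ⊗ B`, with orthonormal rows. -/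
structure IsIsometryMatrix (e : ι → Γ) (bar : ι → ι) (v : Matrix ι ι B) : Prop where
  rel : ∀ L : List ι, (L.map e).prod = 1 → (L.map (coactGen e v)).prod = 1
  trace : ∀ L : List ι, (L.map e).prod ≠ 1 → tensorCoeff B 1 (L.map (coactGen e v)).prod = 0
  star_apply : ∀ J I, star (v J I) = v (bar J) (bar I)
  row : ∀ K L, ∑ I, v K I * star (v L I) = if K = L then 1 else 0

namespace IsSymmGen

variable {e : ι → Γ} {bar : ι → ι} (he : IsSymmGen e bar)
include he

lemma bar_injective : Function.Injective bar := fun I J h => by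
  rw [← he.bar_bar I, h, he.bar_bar]

lemma mul_bar (I : ι) : e I * e (bar I) = 1 := by rw [he.inv, mul_inv_cancel]

lemma mul_eq_one_iff (I J : ι) : e I * e J = 1 ↔ J = bar I := by
  rw [mul_eq_one_iff_eq_inv', ← he.inv, he.inj.eq_iff]

lemma prod_map_bar (L : List ι) : ((L.map bar).reverse.map e).prod = (L.map e).prod⁻¹ := by
  induction L with
  | nil => simp
  | cons I L ih => simp_all [he.inv]

lemma star_coactGen {v : Matrix ι ι B} (hv : ∀ J I, star (v J I) = v (bar J) (bar I)) (I : ι) :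
    star (coactGen e v I) = coactGen e v (bar I) := by
  have h : ∀ J, star (MonoidAlgebra.single (e J) (1 : ℂ) ⊗ₜ[ℂ] v J I) =
      MonoidAlgebra.single (e (bar J)) (1 : ℂ) ⊗ₜ[ℂ] v (bar J) (bar I) := fun J => by
    rw [TensorProduct.star_tmul, groupAlgebra_star_single, star_one, he.inv, hv]
  rw [coactGen, star_sum, coactGen]
  simp only [h]
  exact Function.Involutive.bijective he.bar_bar |>.sum_comp
    (g := fun J => MonoidAlgebra.single (e J) (1 : ℂ) ⊗ₜ[ℂ] v J (bar I))

lemma star_prod_coactGen {v : Matrix ι ι B} (hv : ∀ J I, star (v J I) = v (bar J) (bar I))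
    (L : List ι) : star (L.map (coactGen e v)).prod =
      ((L.map bar).reverse.map (coactGen e v)).prod := by
  induction L with
  | nil => simp
  | cons I L ih =>
    simp only [List.map_cons, List.prod_cons, star_mul, ih, List.reverse_cons, List.map_append,
      List.prod_append, List.map_nil, List.prod_nil, mul_one, he.star_coactGen hv]

/-- A product of two generators is 1 only for a pair `J`, `bar J`, by injectivity of `e`. -/
lemma tensorCoeff_one_mul (v : Matrix ι ι B) (I I' : ι) :
    tensorCoeff B 1 (coactGen e v I * coactGen e v I') = ∑ J, v J I * v (bar J) I' := by
  classical
  simp only [coactGen, Finset.sum_mul_sum, Algebra.TensorProduct.tmul_mul_tmul,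
    MonoidAlgebra.single_mul_single, mul_one, map_sum, tensorCoeff_single_tmul, he.mul_eq_one_iff,
    Finset.sum_ite_eq', Finset.mem_univ, if_true]

end IsSymmGen

namespace IsIsometryMatrix

variable {e : ι → Γ} {bar : ι → ι}

lemma map {v : Matrix ι ι B} (hv : IsIsometryMatrix e bar v) (f : B →⋆ₐ[ℂ] B') :
    IsIsometryMatrix e bar (v.map f) where
  rel L h := by rw [← mapCoeff_prod_coactGen, hv.rel L h, map_one]
  trace L h := by rw [← mapCoeff_prod_coactGen, tensorCoeff_mapCoeff, hv.trace L h, map_zero]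
  star_apply J I := by simp [← map_star, hv.star_apply]
  row K L := by
    simp only [Matrix.map_apply, ← map_star, ← map_mul, ← map_sum, hv.row]
    split_ifs <;> simp

/-- All the conditions are equations, so a jointly injective family of homomorphisms detects them.
-/
lemma of_family {v : Matrix ι ι B} {κ : Type*} {C : κ → Type u} [∀ k, CStarAlgebra (C k)]
    (f : ∀ k, B →⋆ₐ[ℂ] C k) (hf : ∀ b b', (∀ k, f k b = f k b') → b = b')
    (hv : ∀ k, IsIsometryMatrix e bar (v.map (f k))) : IsIsometryMatrix e bar v where
  rel L h := tensorCoeff_ext fun g => hf _ _ fun k => by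
    rw [← tensorCoeff_mapCoeff, ← tensorCoeff_mapCoeff, mapCoeff_prod_coactGen, (hv k).rel L h,
      map_one (mapCoeff Γ (f k))]
  trace L h := hf _ _ fun k => by
    rw [← tensorCoeff_mapCoeff, mapCoeff_prod_coactGen, (hv k).trace L h, map_zero]
  star_apply J I := hf _ _ fun k => by
    rw [map_star]
    exact (hv k).star_apply J I
  row K L := hf _ _ fun k => by
    have := (hv k).row K L
    simp only [Matrix.map_apply, ← map_star, ← map_mul, ← map_sum] at this
    rw [this]
    split_ifs <;> simp

/-- This is the trivial action `g ↦ g ⊗ 1`; it keeps the universal algebra from being zero. -/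
lemma one (he : IsSymmGen e bar) : IsIsometryMatrix e bar (1 : Matrix ι ι B) := by
  have h : ∀ L : List ι, (L.map (coactGen e (1 : Matrix ι ι B))).prod =
      MonoidAlgebra.single (L.map e).prod 1 ⊗ₜ 1 := fun L => by
    induction L with
    | nil => rfl
    | cons I L ih =>
      have : coactGen e (1 : Matrix ι ι B) I = MonoidAlgebra.single (e I) 1 ⊗ₜ 1 := by
        rw [coactGen, Finset.sum_eq_single I]
        · simp
        · intro J _ hJ; simp [hJ]
        · simp
      rw [List.map_cons, List.prod_cons, ih, this, Algebra.TensorProduct.tmul_mul_tmul,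
        MonoidAlgebra.single_mul_single, mul_one, mul_one, List.map_cons, List.prod_cons]
  classical
  refine ⟨fun L hL => ?_, fun L hL => ?_, fun J I => ?_, fun K L => ?_⟩
  · rw [h, hL]; rfl
  · rw [h, tensorCoeff_single_tmul, if_neg hL]
  · rw [Matrix.one_apply, Matrix.one_apply, apply_ite star, star_one, star_zero]
    simp only [he.bar_injective.eq_iff]
  · rcases eq_or_ne K L with rfl | hKL
    · simp [Matrix.one_apply]
    · simp [Matrix.one_apply, hKL, hKL.symm]

section Coaction

variable {v : Matrix ι ι B} (hv : IsIsometryMatrix e bar v) (he : IsSymmGen e bar)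
include hv he

/-- If `M` is a word for the inverse, then `L'M` and `ML` both represent 1, so the images of `L` and
`L'` are inverses of the image of `M`, on the right and on the left. -/
lemma prod_eq_of_prod_eq {L L' : List ι} (h : (L.map e).prod = (L'.map e).prod) :
    (L.map (coactGen e v)).prod = (L'.map (coactGen e v)).prod := by
  let M := (L'.map bar).reverse
  have hM : (M.map e).prod = (L'.map e).prod⁻¹ := he.prod_map_bar L'
  have h1 := hv.rel (L' ++ M) (by simp [hM])
  have h2 := hv.rel (M ++ L) (by simp [hM, h])
  rw [List.map_append, List.prod_append] at h1 h2
  calc _ = ((L'.map (coactGen e v)).prod * (M.map (coactGen e v)).prod) *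
        (L.map (coactGen e v)).prod := by rw [h1, one_mul]
    _ = _ := by rw [mul_assoc, h2, mul_one]

/-- The `*`-homomorphism `ℂΓ → ℂΓ ⊗ B` with `e_I ↦ ∑_J e_J ⊗ v_{JI}`. -/
def coact : MonoidAlgebra ℂ Γ →⋆ₐ[ℂ] MonoidAlgebra ℂ Γ ⊗[ℂ] B :=
  let φ : Γ →* MonoidAlgebra ℂ Γ ⊗[ℂ] B :=
    { toFun := fun g => ((he.gen g).choose.map (coactGen e v)).prod
      map_one' := hv.rel _ (he.gen 1).choose_spec
      map_mul' := fun g h => by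
        rw [← List.prod_append, ← List.map_append]
        apply hv.prod_eq_of_prod_eq he
        rw [List.map_append, List.prod_append, (he.gen g).choose_spec, (he.gen h).choose_spec,
          (he.gen (g * h)).choose_spec] }
  { MonoidAlgebra.lift ℂ (MonoidAlgebra ℂ Γ ⊗[ℂ] B) Γ φ with
    map_star' := fun x => by
      change MonoidAlgebra.lift ℂ (MonoidAlgebra ℂ Γ ⊗[ℂ] B) Γ φ (star x) =
        star (MonoidAlgebra.lift ℂ (MonoidAlgebra ℂ Γ ⊗[ℂ] B) Γ φ x)
      induction x using MonoidAlgebra.induction_linear with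
      | zero => simp
      | add x y hx hy => rw [star_add, map_add, map_add, star_add, hx, hy]
      | single g c =>
        rw [groupAlgebra_star_single, MonoidAlgebra.lift_single, MonoidAlgebra.lift_single,
          star_smul]
        congr 1
        change ((he.gen g⁻¹).choose.map (coactGen e v)).prod =
          star ((he.gen g).choose.map (coactGen e v)).prod
        rw [he.star_prod_coactGen hv.star_apply]
        apply hv.prod_eq_of_prod_eq he
        rw [he.prod_map_bar, (he.gen g).choose_spec, (he.gen g⁻¹).choose_spec] }

lemma coact_prod (L : List ι) : hv.coact he (MonoidAlgebra.single (L.map e).prod 1) =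
    (L.map (coactGen e v)).prod := by
  refine (MonoidAlgebra.lift_single _ _ _).trans ?_
  rw [one_smul]
  exact hv.prod_eq_of_prod_eq he (he.gen _).choose_spec

lemma coact_gen (I : ι) : hv.coact he (MonoidAlgebra.single (e I) 1) = coactGen e v I := by
  simpa using hv.coact_prod he [I]

lemma tensorCoeff_one_coact (x : MonoidAlgebra ℂ Γ) :
    tensorCoeff B 1 (hv.coact he x) = groupCoeff 1 x • (1 : B) := by
  classical
  induction x using MonoidAlgebra.induction_linear with
  | zero => simp
  | add x y hx hy => rw [map_add, map_add, map_add, hx, hy, add_smul]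
  | single g c =>
    have h1 : MonoidAlgebra.single g c = c • MonoidAlgebra.single g (1 : ℂ) := by
      rw [MonoidAlgebra.smul_single, smul_eq_mul, mul_one]
    obtain ⟨L, rfl⟩ := he.gen g
    rw [h1, map_smul, map_smul, map_smul, coact_prod, groupCoeff_single]
    split_ifs with h
    · rw [hv.rel L h, Algebra.TensorProduct.one_def, tensorCoeff_tmul, MonoidAlgebra.one_def,
        groupCoeff_single, if_pos rfl]
      simp
    · rw [hv.trace L h]
      simp

/-- The left side is the coefficient at 1 of the image of `e_K e_L⁻¹`, so column relations come from
trace invariance and need not be assumed. -/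
lemma column (K L : ι) : ∑ J, v J K * star (v J L) = if K = L then 1 else 0 := by
  classical
  simp only [hv.star_apply]
  rw [← he.tensorCoeff_one_mul, ← hv.coact_gen he, ← hv.coact_gen he, ← map_mul,
    tensorCoeff_one_coact, MonoidAlgebra.single_mul_single, groupCoeff_single, he.mul_eq_one_iff,
    he.bar_injective.eq_iff]
  simp only [eq_comm (a := L)]
  split_ifs <;> simp

end Coaction

end IsIsometryMatrix

/-- A `*`-homomorphism from `ℂΓ` is determined by the images of the generators. -/
lemma IsSymmGen.hom_ext {e : ι → Γ} {bar : ι → ι} (he : IsSymmGen e bar)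
    {α β : MonoidAlgebra ℂ Γ →⋆ₐ[ℂ] MonoidAlgebra ℂ Γ ⊗[ℂ] B}
    (h : ∀ I, α (MonoidAlgebra.single (e I) 1) = β (MonoidAlgebra.single (e I) 1))
    (x : MonoidAlgebra ℂ Γ) : α x = β x := by
  have key : ∀ L : List ι, α (MonoidAlgebra.single (L.map e).prod 1) =
      β (MonoidAlgebra.single (L.map e).prod 1) := fun L => by
    induction L with
    | nil => rw [List.map_nil, List.prod_nil, ← MonoidAlgebra.one_def, map_one, map_one]
    | cons I L ih =>
      have : MonoidAlgebra.single ((I :: L).map e).prod (1 : ℂ) =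
          MonoidAlgebra.single (e I) 1 * MonoidAlgebra.single (L.map e).prod 1 := by
        rw [MonoidAlgebra.single_mul_single, mul_one, List.map_cons, List.prod_cons]
      rw [this, map_mul, map_mul, h, ih]
  induction x using MonoidAlgebra.induction_linear with
  | zero => simp
  | add x y hx hy => rw [map_add, map_add, hx, hy]
  | single g c =>
    obtain ⟨L, rfl⟩ := he.gen g
    have h1 : MonoidAlgebra.single (L.map e).prod c =
        c • MonoidAlgebra.single (L.map e).prod (1 : ℂ) := by
      rw [MonoidAlgebra.smul_single, smul_eq_mul, mul_one]
    rw [h1, map_smul, map_smul, key]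

namespace MinTensor

variable {A : Type u} [CStarAlgebra A]

/-- The homomorphism `a ↦ a ⊗ 1`. -/
def inl : A →⋆ₐ[ℂ] MinTensor A B where
  toFun a := tmul a 1
  map_one' := tmul_one_one
  map_mul' a b := by rw [tmul_mul_tmul, mul_one]
  map_zero' := zero_tmul 1
  map_add' a b := by simp only [← ofTensor_tmul, TensorProduct.add_tmul, map_add]
  commutes' r := by
    simp only [Algebra.algebraMap_eq_smul_one, ← ofTensor_tmul, ← TensorProduct.smul_tmul',
      map_smul]
    rw [ofTensor_tmul, tmul_one_one]
  map_star' a := by rw [star_tmul, star_one]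

/-- The homomorphism `b ↦ 1 ⊗ b`. -/
def inr : B →⋆ₐ[ℂ] MinTensor A B where
  toFun a := tmul 1 a
  map_one' := tmul_one_one
  map_mul' a b := by rw [tmul_mul_tmul, mul_one]
  map_zero' := tmul_zero 1
  map_add' a b := by simp only [← ofTensor_tmul, TensorProduct.tmul_add, map_add]
  commutes' r := by
    simp only [Algebra.algebraMap_eq_smul_one, ← ofTensor_tmul, TensorProduct.tmul_smul,
      map_smul]
    rw [ofTensor_tmul, tmul_one_one]
  map_star' a := by rw [star_tmul, star_one]

lemma inl_mul_inr (a : A) (b : B) : (inl a : MinTensor A B) * inr b = tmul a b := by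
  change tmul a 1 * tmul 1 b = _
  rw [tmul_mul_tmul, mul_one, one_mul]

lemma inr_mul_inl (a : A) (b : B) : (inr b : MinTensor A B) * inl a = tmul a b := by
  change tmul 1 b * tmul a 1 = _
  rw [tmul_mul_tmul, mul_one, one_mul]

end MinTensor

/-- The matrix product of `v` and `w`, with entries `∑_K v_{JK} ⊗ w_{KI}` in `B ⊗ B'`. -/
def matrixTensor (v : Matrix ι ι B) (w : Matrix ι ι B') : Matrix ι ι (MinTensor B B') :=
  fun J I => ∑ K, MinTensor.tmul (v J K) (w K I)

lemma tensorPower_matrixTensor (v : Matrix ι ι B) (w : Matrix ι ι B') {r : ℕ} (J I : Fin r → ι) :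
    tensorPower (matrixTensor v w) r J I =
      ∑ K, MinTensor.tmul (tensorPower v r J K) (tensorPower w r K I) := by
  induction r with
  | zero => simp [tensorPower_zero, MinTensor.tmul_one_one]
  | succ r ih =>
    obtain ⟨j, J, rfl⟩ : ∃ a A, Fin.cons a A = J := ⟨J 0, Fin.tail J, Fin.cons_self_tail J⟩
    obtain ⟨i, I, rfl⟩ : ∃ a A, Fin.cons a A = I := ⟨I 0, Fin.tail I, Fin.cons_self_tail I⟩
    rw [sum_fin_succ, tensorPower_cons, ih, matrixTensor, Finset.sum_mul_sum]
    simp only [MinTensor.tmul_mul_tmul, tensorPower_cons]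

/-- Applying the coaction of `v` to the group leg of `ℂΓ ⊗ B'`, and `1 ⊗ b` to the other, gives two
commuting homomorphisms, hence a homomorphism `Θ`. It carries the generators' images under `w` to
those under the product matrix and respects the trace, so the word conditions for `w` are
transported. -/
lemma IsIsometryMatrix.matrixTensor {e : ι → Γ} {bar : ι → ι} (he : IsSymmGen e bar)
    {v : Matrix ι ι B} {w : Matrix ι ι B'} (hv : IsIsometryMatrix e bar v)
    (hw : IsIsometryMatrix e bar w) : IsIsometryMatrix e bar (matrixTensor v w) := by
  let X := MonoidAlgebra ℂ Γ ⊗[ℂ] MinTensor B B'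
  let φ : MonoidAlgebra ℂ Γ →ₐ[ℂ] X := (mapCoeff Γ MinTensor.inl).comp (hv.coact he).toAlgHom
  let ψ : B' →ₐ[ℂ] X := Algebra.TensorProduct.includeRight.comp MinTensor.inr.toAlgHom
  have hcomm : ∀ x b, Commute (φ x) (ψ b) := fun x b => by
    change mapCoeff Γ MinTensor.inl (hv.coact he x) * (1 ⊗ₜ MinTensor.inr b) =
      (1 ⊗ₜ MinTensor.inr b) * mapCoeff Γ MinTensor.inl (hv.coact he x)
    induction hv.coact he x using TensorProduct.induction_on with
    | zero => simp
    | add x y hx hy => simp only [map_add, add_mul, mul_add, hx, hy]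
    | tmul x c =>
      rw [mapCoeff_tmul, Algebra.TensorProduct.tmul_mul_tmul, Algebra.TensorProduct.tmul_mul_tmul,
        MinTensor.inl_mul_inr, MinTensor.inr_mul_inl, mul_one, one_mul]
  let Θ : MonoidAlgebra ℂ Γ ⊗[ℂ] B' →ₐ[ℂ] X := Algebra.TensorProduct.lift φ ψ hcomm
  have hΘ : ∀ x b, Θ (x ⊗ₜ b) = mapCoeff Γ MinTensor.inl (hv.coact he x) *
      (1 ⊗ₜ MinTensor.inr b) := fun x b => Algebra.TensorProduct.lift_tmul _ _ _ _ _
  have hgen : ∀ I, Θ (coactGen e w I) = coactGen e (_root_.matrixTensor v w) I := fun I => by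
    simp only [coactGen, map_sum, hΘ, hv.coact_gen he, mapCoeff_tmul, Finset.sum_mul,
      Algebra.TensorProduct.tmul_mul_tmul, mul_one, MinTensor.inl_mul_inr, _root_.matrixTensor,
      TensorProduct.tmul_sum]
    exact Finset.sum_comm
  have hprod : ∀ L : List ι, (L.map (coactGen e (_root_.matrixTensor v w))).prod =
      Θ (L.map (coactGen e w)).prod := fun L => by
    simp only [map_list_prod, List.map_map, Function.comp_def, hgen]
  have htr : ∀ y, tensorCoeff (MinTensor B B') 1 (Θ y) =
      MinTensor.inr (tensorCoeff B' 1 y) := fun y => by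
    induction y using TensorProduct.induction_on with
    | zero => simp
    | add x y hx hy => simp only [map_add, hx, hy]
    | tmul x b =>
      rw [hΘ, tensorCoeff_mul_tmul, tensorCoeff_mapCoeff, hv.tensorCoeff_one_coact he,
        tensorCoeff_tmul, map_smul, map_smul, map_one, smul_mul_assoc, one_mul]
  refine ⟨fun L hL => ?_, fun L hL => ?_, fun J I => ?_, fun K L => ?_⟩
  · rw [hprod, hw.rel L hL, map_one]
  · rw [hprod, htr, hw.trace L hL, map_zero]
  · simp only [_root_.matrixTensor, star_sum, MinTensor.star_tmul, hv.star_apply, hw.star_apply]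
    exact Function.Involutive.bijective he.bar_bar |>.sum_comp
      (g := fun K => MinTensor.tmul (v (bar J) K) (w K (bar I)))
  · simp only [_root_.matrixTensor, star_sum, MinTensor.star_tmul, Finset.sum_mul_sum,
      MinTensor.tmul_mul_tmul]
    rw [Finset.sum_comm]
    have : ∀ M, ∑ I, ∑ M', MinTensor.tmul (v K M * star (v L M')) (w M I * star (w M' I)) =
        MinTensor.tmul (v K M * star (v L M)) 1 := fun M => by
      rw [Finset.sum_comm]
      simp only [← MinTensor.tmul_sum, hw.row]
      rw [Finset.sum_eq_single M]
      · simp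
      · intro M' _ hM; rw [if_neg hM.symm, MinTensor.tmul_zero]
      · simp
    simp only [this, ← MinTensor.sum_tmul, hv.row]
    split_ifs
    · exact MinTensor.tmul_one_one
    · exact MinTensor.zero_tmul _

end IsometryMatrix

/-! ### The universal isometry matrix -/

section UniversalMatrix

variable {Γ : Type} [Group Γ] {ι : Type} [Fintype ι] [DecidableEq ι] {B B' : Type u}
  [CStarAlgebra B] [CStarAlgebra B']

/-- Evaluation of noncommutative polynomials at the entries of a matrix. -/
def evalMatrix (v : Matrix ι ι B) : FreeAlgebra ℂ (ι × ι) →ₐ[ℂ] B :=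
  FreeAlgebra.lift ℂ fun p => v p.1 p.2

lemma evalMatrix_gen (v : Matrix ι ι B) (J I : ι) :
    evalMatrix v (FreeAlgebra.ι ℂ (J, I)) = v J I := by
  simp [evalMatrix]

lemma map_evalMatrix (f : B →⋆ₐ[ℂ] B') (v : Matrix ι ι B) (x : FreeAlgebra ℂ (ι × ι)) :
    f (evalMatrix v x) = evalMatrix (v.map f) x := by
  have : f.toAlgHom.comp (evalMatrix v) = evalMatrix (v.map f) := by
    apply FreeAlgebra.hom_ext
    ext p
    obtain ⟨J, I⟩ := p
    change f (evalMatrix v (FreeAlgebra.ι ℂ (J, I))) = evalMatrix _ (FreeAlgebra.ι ℂ (J, I))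
    rw [evalMatrix_gen, evalMatrix_gen]
    rfl
  exact DFunLike.congr_fun this x

/-- The polynomial `y` is chosen before `B` and `v`. This uniformity shows that a map defined by
comparing evaluations at two matrices preserves adjoints. -/
lemma exists_star_evalMatrix (bar : ι → ι) (x : FreeAlgebra ℂ (ι × ι)) :
    ∃ y : FreeAlgebra ℂ (ι × ι), ∀ (B : Type u) [CStarAlgebra B] (v : Matrix ι ι B),
      (∀ J I, star (v J I) = v (bar J) (bar I)) → star (evalMatrix v x) = evalMatrix v y := by
  induction x using FreeAlgebra.induction with
  | grade0 r =>
    refine ⟨algebraMap ℂ _ (star r), fun B _ v _ => ?_⟩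
    rw [AlgHom.commutes, AlgHom.commutes, algebraMap_star_comm]
  | grade1 p =>
    refine ⟨FreeAlgebra.ι ℂ (bar p.1, bar p.2), fun B _ v hv => ?_⟩
    obtain ⟨J, I⟩ := p
    rw [evalMatrix_gen, evalMatrix_gen, hv]
  | mul a b ha hb =>
    obtain ⟨y, hy⟩ := ha
    obtain ⟨z, hz⟩ := hb
    exact ⟨z * y, fun B _ v hv => by rw [map_mul, star_mul, map_mul, hy B v hv, hz B v hv]⟩
  | add a b ha hb =>
    obtain ⟨y, hy⟩ := ha
    obtain ⟨z, hz⟩ := hb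
    exact ⟨y + z, fun B _ v hv => by rw [map_add, star_add, map_add, hy B v hv, hz B v hv]⟩

lemma starAlgHom_ext_of_dense {v : Matrix ι ι B} (hd : DenseRange (evalMatrix v))
    {f g : B →⋆ₐ[ℂ] B'} (h : ∀ J I, f (v J I) = g (v J I)) : f = g := by
  refine DFunLike.coe_injective (hd.equalizer f.continuous_of_cstar g.continuous_of_cstar ?_)
  ext x
  change f (evalMatrix v x) = g (evalMatrix v x)
  rw [map_evalMatrix, map_evalMatrix]
  congr 1
  exact congrArg _ (Matrix.ext h)

/-- `v` is the universal isometry matrix, with entries generating `A`. -/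
structure IsUniversalMatrix {A : Type u} [CStarAlgebra A] (e : ι → Γ) (bar : ι → ι)
    (v : Matrix ι ι A) : Prop where
  isometry : IsIsometryMatrix e bar v
  dense : DenseRange (evalMatrix v)
  exists_hom : ∀ (B : Type u) [CStarAlgebra B] (w : Matrix ι ι B), IsIsometryMatrix e bar w →
    ∃ f : A →⋆ₐ[ℂ] B, ∀ J I, f (v J I) = w J I

section LpEval

variable {κ : Type u} (C : κ → Type u) [∀ k, CStarAlgebra (C k)] [∀ k, Nontrivial (C k)]

/-- The product of a family of C*-algebras. -/
abbrev CStarProd : Type u := lp C ∞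

instance : CStarAlgebra (CStarProd C) where

/-- The projections of a product of C*-algebras. -/
def CStarProd.eval (k : κ) : CStarProd C →⋆ₐ[ℂ] C k where
  toFun x := x k
  map_one' := rfl
  map_mul' _ _ := rfl
  map_zero' := rfl
  map_add' _ _ := rfl
  commutes' _ := rfl
  map_star' _ := rfl

end LpEval

/-- The norms on noncommutative polynomials coming from isometry matrices. -/
def IsometrySeminorm (e : ι → Γ) (bar : ι → ι) : Type :=
  {p : FreeAlgebra ℂ (ι × ι) → ℝ // ∃ (B : Type u) (_ : CStarAlgebra B) (_ : Nontrivial B)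
    (w : Matrix ι ι B), IsIsometryMatrix e bar w ∧ ∀ x, p x = ‖evalMatrix w x‖}

theorem exists_isUniversalMatrix {e : ι → Γ} {bar : ι → ι} (he : IsSymmGen e bar) :
    ∃ (A : Type u) (_ : CStarAlgebra A) (_ : Nontrivial A) (v : Matrix ι ι A),
      IsUniversalMatrix e bar v := by
  -- Indexing by all C*-algebras `B : Type u` would leave the universe. The seminorms they induce on
  -- noncommutative polynomials form a small type, and one representative of each is enough.
  let κ : Type u := ULift.{u} (IsometrySeminorm.{u} e bar)
  choose C instC instN w hw hnorm using fun k : κ => k.down.2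
  let v₀ : Matrix ι ι (CStarProd C) := fun J I => ⟨fun k => w k J I, memℓp_infty ⟨1, by
    rintro _ ⟨k, rfl⟩
    refine norm_le_one_of_sum_mul_star (a := fun I => w k J I) ?_ I
    rw [(hw k).row, if_pos rfl]⟩⟩
  let A₀ : StarSubalgebra ℂ (CStarProd C) := StarAlgebra.adjoin ℂ {x | ∃ J I, x = v₀ J I}
  let A := A₀.topologicalClosure
  have hclosed : IsClosed (A : Set (CStarProd C)) := StarSubalgebra.isClosed_topologicalClosure _
  let v : Matrix ι ι A := fun J I => ⟨v₀ J I, StarSubalgebra.le_topologicalClosure _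
    (StarAlgebra.subset_adjoin ℂ _ ⟨J, I, rfl⟩)⟩
  let f : ∀ k, A →⋆ₐ[ℂ] C k := fun k => (CStarProd.eval C k).comp A.subtype
  have hfv : ∀ k, v.map (f k) = w k := fun k => rfl
  have hv : IsIsometryMatrix e bar v :=
    .of_family f (fun b b' h => Subtype.ext (lp.ext (funext h))) fun k => by rw [hfv]; exact hw k
  have hdense : DenseRange (evalMatrix v) := by
    rintro ⟨x, hx⟩
    refine (closure_subtype (p := fun x => x ∈ A)).2 (closure_mono ?_ hx)
    intro y hy
    suffices ∃ x, (evalMatrix v x : CStarProd C) = y by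
      obtain ⟨x, rfl⟩ := this
      exact ⟨_, ⟨x, rfl⟩, rfl⟩
    induction hy using StarAlgebra.adjoin_induction with
    | mem x h =>
      obtain ⟨J, I, rfl⟩ := h
      exact ⟨FreeAlgebra.ι ℂ (J, I), by rw [evalMatrix_gen]⟩
    | algebraMap r => exact ⟨algebraMap ℂ _ r, by rw [AlgHom.commutes]; rfl⟩
    | add x y _ _ hx hy =>
      obtain ⟨x, rfl⟩ := hx
      obtain ⟨y, rfl⟩ := hy
      exact ⟨x + y, by rw [map_add]; rfl⟩
    | mul x y _ _ hx hy =>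
      obtain ⟨x, rfl⟩ := hx
      obtain ⟨y, rfl⟩ := hy
      exact ⟨x * y, by rw [map_mul]; rfl⟩
    | star x _ hx =>
      obtain ⟨x, rfl⟩ := hx
      obtain ⟨y, hy⟩ := exists_star_evalMatrix.{u} bar x
      exact ⟨y, by rw [← hy A v hv.star_apply]; rfl⟩
  have hlift : ∀ (B : Type u) [CStarAlgebra B] (u : Matrix ι ι B), IsIsometryMatrix e bar u →
      ∃ f : A →⋆ₐ[ℂ] B, ∀ J I, f (v J I) = u J I := by
    intro B _ u hu
    -- The zero algebra is not among the factors of the product, so it is treated apart.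
    rcases subsingleton_or_nontrivial B with hB | hB
    · exact ⟨{ toFun := fun _ => 0
               map_one' := Subsingleton.elim _ _
               map_mul' := fun _ _ => Subsingleton.elim _ _
               map_zero' := rfl
               map_add' := fun _ _ => Subsingleton.elim _ _
               commutes' := fun _ => Subsingleton.elim _ _
               map_star' := fun _ => Subsingleton.elim _ _ }, fun _ _ => Subsingleton.elim _ _⟩
    -- The representative `w k` chosen for this seminorm may differ from `u`, even in its algebra;
    -- only the norms of polynomials are compared.
    let k : κ := ⟨⟨fun x => ‖evalMatrix u x‖, B, inferInstance, hB, u, hu, fun _ => rfl⟩⟩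
    have hle : ∀ x, ‖evalMatrix u x‖ ≤ ‖evalMatrix v x‖ := fun x => by
      rw [show ‖evalMatrix u x‖ = ‖evalMatrix (w k) x‖ from hnorm k x, ← hfv k, ← map_evalMatrix]
      exact (f k).norm_map_le _
    obtain ⟨g, hg⟩ := exists_starAlgHom_of_norm_le (evalMatrix v) (evalMatrix u) hdense hle
      fun x => by
        obtain ⟨y, hy⟩ := exists_star_evalMatrix.{u} bar x
        exact ⟨y, hy A v hv.star_apply, hy B u hu.star_apply⟩
    refine ⟨g, fun J I => ?_⟩
    rw [← evalMatrix_gen v, hg, evalMatrix_gen]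
  have hnon : Nontrivial A := by
    obtain ⟨f, -⟩ := hlift C(PUnit.{u + 1}, ℂ) 1 (IsIsometryMatrix.one he)
    refine ⟨⟨1, 0, fun h => ?_⟩⟩
    have := congrArg f h
    rw [map_one, map_zero] at this
    exact one_ne_zero this
  exact ⟨A, inferInstance, hnon, v, hv, hdense, hlift⟩

end UniversalMatrix

/-! ### Compact quantum groups generated by a matrix -/

section MatrixQuantumGroup

variable {ι : Type} [Fintype ι] [DecidableEq ι] {A : Type u} [CStarAlgebra A]

lemma tensorPower_of_list (v : Matrix ι ι A) (L : List (ι × ι)) :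
    tensorPower v L.length (fun k => (L.get k).1) (fun k => (L.get k).2) =
      (L.map fun p => v p.1 p.2).prod := by
  rw [tensorPower]
  congr 1
  exact List.ext_getElem (by simp) (by simp)

/-- The products of entries of `v` span a dense subspace if the polynomials are dense. -/
lemma dense_span_tensorPower {v : Matrix ι ι A} (hd : DenseRange (evalMatrix v)) :
    Dense (Submodule.span ℂ {a | ∃ (r : ℕ) (J I : Fin r → ι), a = tensorPower v r J I} :
      Set A) := by
  refine hd.mono ?_
  rintro _ ⟨x, rfl⟩
  have h : evalMatrix v x ∈ Submodule.span ℂ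
      {a | ∃ L : List (ι × ι), a = (L.map fun p => v p.1 p.2).prod} := by
    induction x using FreeAlgebra.induction with
    | grade0 r =>
      rw [AlgHom.commutes, Algebra.algebraMap_eq_smul_one]
      exact Submodule.smul_mem _ _ (Submodule.subset_span ⟨[], by simp⟩)
    | grade1 p => exact Submodule.subset_span ⟨[p], by simp [evalMatrix]⟩
    | mul a b ha hb =>
      rw [map_mul]
      have := Submodule.mul_mem_mul ha hb
      rw [Submodule.span_mul_span] at this
      refine Submodule.span_mono ?_ this
      rintro _ ⟨_, ⟨L, rfl⟩, _, ⟨M, rfl⟩, rfl⟩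
      exact ⟨L ++ M, by simp⟩
    | add a b ha hb => rw [map_add]; exact add_mem ha hb
  refine Submodule.span_mono ?_ h
  rintro _ ⟨L, rfl⟩
  exact ⟨_, _, _, (tensorPower_of_list v L).symm⟩

lemma CState.ext_of_dense {v : Matrix ι ι A} (hd : DenseRange (evalMatrix v)) {φ ψ : CState A}
    (h : ∀ (r : ℕ) (J I : Fin r → ι),
      φ.toLin (tensorPower v r J I) = ψ.toLin (tensorPower v r J I)) : φ = ψ := by
  refine CState.ext fun a => congrFun (Continuous.ext_on (dense_span_tensorPower hd)
    φ.continuous_toLin ψ.continuous_toLin ?_) a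
  apply LinearMap.eqOn_span
  rintro _ ⟨r, J, I, rfl⟩
  exact h r J I

lemma comul_tensorPower {v : Matrix ι ι A} {Δ : A →⋆ₐ[ℂ] MinTensor A A}
    (hΔ : ∀ J I, Δ (v J I) = matrixTensor v v J I) {r : ℕ} (J I : Fin r → ι) :
    Δ (tensorPower v r J I) =
      ∑ K, MinTensor.tmul (tensorPower v r J K) (tensorPower v r K I) := by
  rw [map_tensorPower, ← tensorPower_matrixTensor]
  congr 1
  exact Matrix.ext hΔ

lemma CState.conv_tensorPower {v : Matrix ι ι A} {Δ : A →⋆ₐ[ℂ] MinTensor A A}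
    (hΔ : ∀ J I, Δ (v J I) = matrixTensor v v J I) (φ ψ : CState A) {r : ℕ} (J I : Fin r → ι) :
    (CState.conv Δ φ ψ).toLin (tensorPower v r J I) =
      ∑ K, φ.toLin (tensorPower v r J K) * ψ.toLin (tensorPower v r K I) := by
  change (φ.prod ψ).toLin (Δ (tensorPower v r J I)) = _
  rw [comul_tensorPower hΔ, map_sum]
  simp only [CState.prod_tmul]

lemma dense_span_of_tmul_mem {W : Submodule ℂ (MinTensor A A)} {D D' : Set A} (hD : Dense D)
    (hD' : Dense D') (h : ∀ a ∈ D, ∀ b ∈ D', MinTensor.tmul a b ∈ W) :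
    Dense (W : Set (MinTensor A A)) := by
  have h1 : ∀ a b, MinTensor.tmul a b ∈ W.topologicalClosure := by
    have hcl : IsClosed (W.topologicalClosure : Set (MinTensor A A)) :=
      W.isClosed_topologicalClosure
    have h2 : ∀ a ∈ D, ∀ b, MinTensor.tmul a b ∈ W.topologicalClosure := fun a ha b =>
      hD'.induction (P := fun b => MinTensor.tmul a b ∈ W.topologicalClosure)
        (fun b hb => W.le_topologicalClosure (h a ha b hb))
        (hcl.preimage (MinTensor.continuous_tmul_right a)) b
    exact fun a b => hD.induction (P := fun a => MinTensor.tmul a b ∈ W.topologicalClosure)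
        (fun a ha => h2 a ha b) (hcl.preimage (MinTensor.continuous_tmul_left b)) a
  have h3 : Submodule.span ℂ {x : MinTensor A A | ∃ a b, x = MinTensor.tmul a b} ≤
      W.topologicalClosure := by
    rw [Submodule.span_le]
    rintro _ ⟨a, b, rfl⟩
    exact h1 a b
  have h4 : Dense (W.topologicalClosure : Set (MinTensor A A)) :=
    MinTensor.dense_span_tmul.mono h3
  rw [Submodule.topologicalClosure_coe] at h4
  exact dense_closure.1 h4

/-- The compact matrix quantum group with fundamental representation `v`. -/
def CompactQuantumGroup.ofMatrix [Nontrivial A] (v : Matrix ι ι A)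
    (Δ : A →⋆ₐ[ℂ] MinTensor A A) (hΔ : ∀ J I, Δ (v J I) = matrixTensor v v J I)
    (hd : DenseRange (evalMatrix v))
    (hrow : ∀ K L, ∑ I, v K I * star (v L I) = if K = L then 1 else 0)
    (hcol : ∀ K L, ∑ J, v J K * star (v J L) = if K = L then 1 else 0) :
    CompactQuantumGroup.{u} where
  alg := A
  comul := Δ
  coassoc φ ψ χ := CState.ext_of_dense hd fun r J I => by
    simp only [CState.conv_tensorPower hΔ, Finset.sum_mul, Finset.mul_sum, mul_assoc]
    exact Finset.sum_comm
  dense_left := by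
    refine dense_span_of_tmul_mem (dense_span_tensorPower hd) dense_univ fun a ha b _ => ?_
    induction ha using Submodule.span_induction with
    | zero => rw [MinTensor.zero_tmul]; exact zero_mem _
    | add x y _ _ hx hy =>
      rw [← MinTensor.ofTensor_tmul, TensorProduct.add_tmul, map_add]
      exact add_mem hx hy
    | smul c x _ hx =>
      rw [← MinTensor.ofTensor_tmul, ← TensorProduct.smul_tmul', map_smul]
      exact Submodule.smul_mem _ _ hx
    | mem a h =>
      obtain ⟨r, J, L, rfl⟩ := h
      -- The adjoint entries play the role of the antipode: orthonormality of the rows collapses the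
      -- sum over the middle index to `L`.
      have key : MinTensor.tmul (tensorPower v r J L) b =
          ∑ I, Δ (tensorPower v r J I) * MinTensor.tmul 1 (star (tensorPower v r L I) * b) := by
        simp only [comul_tensorPower hΔ, Finset.sum_mul, MinTensor.tmul_mul_tmul, mul_one]
        rw [Finset.sum_comm]
        simp only [← MinTensor.tmul_sum, ← mul_assoc, ← Finset.sum_mul, tensorPower_row hrow]
        rw [Finset.sum_eq_single L]
        · simp
        · intro K _ hK; rw [if_neg hK, zero_mul, MinTensor.tmul_zero]
        · simp
      rw [key]
      exact Submodule.sum_mem _ fun I _ => Submodule.subset_span ⟨_, _, rfl⟩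
  dense_right := by
    refine dense_span_of_tmul_mem dense_univ (dense_span_tensorPower hd) fun b _ a ha => ?_
    induction ha using Submodule.span_induction with
    | zero => rw [MinTensor.tmul_zero]; exact zero_mem _
    | add x y _ _ hx hy =>
      rw [← MinTensor.ofTensor_tmul, TensorProduct.tmul_add, map_add]
      exact add_mem hx hy
    | smul c x _ hx =>
      rw [← MinTensor.ofTensor_tmul, TensorProduct.tmul_smul, map_smul]
      exact Submodule.smul_mem _ _ hx
    | mem a h =>
      obtain ⟨r, L, I, rfl⟩ := h
      have key : MinTensor.tmul b (tensorPower v r L I) =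
          ∑ J, Δ (tensorPower v r J I) * MinTensor.tmul (star (tensorPower v r J L) * b) 1 := by
        -- Transposing indices leaves the order of factors in a tensor power unchanged, so the row
        -- lemma also serves for columns.
        have hcol' := fun K L => tensorPower_row (v := v.transpose) (r := r) hcol K L
        simp only [tensorPower_transpose] at hcol'
        simp only [comul_tensorPower hΔ, Finset.sum_mul, MinTensor.tmul_mul_tmul, mul_one]
        rw [Finset.sum_comm]
        simp only [← MinTensor.sum_tmul, ← mul_assoc, ← Finset.sum_mul, hcol']
        rw [Finset.sum_eq_single L]
        · simp
        · intro K _ hK; rw [if_neg hK, zero_mul, MinTensor.zero_tmul]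
        · simp
      rw [key]
      exact Submodule.sum_mem _ fun I _ => Submodule.subset_span ⟨_, _, rfl⟩

/-- A `*`-homomorphism compatible with the comultiplications on the entries of a generating matrix
is a morphism of compact quantum groups. -/
def CQGHom.ofMatrix {G K : CompactQuantumGroup.{u}} (v : Matrix ι ι G.alg)
    (hd : DenseRange (evalMatrix v)) (hG : ∀ J I, G.comul (v J I) = matrixTensor v v J I)
    (f : G.alg →⋆ₐ[ℂ] K.alg)
    (hK : ∀ J I, K.comul (f (v J I)) = matrixTensor (v.map f) (v.map f) J I) : CQGHom G K where
  toHom := f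
  map_comul φ ψ := CState.ext_of_dense hd fun r J I => by
    rw [CState.conv_tensorPower hG]
    change (CState.conv K.comul φ ψ).toLin (f (tensorPower v r J I)) = ∑ L,
      φ.toLin (f (tensorPower v r J L)) * ψ.toLin (f (tensorPower v r L I))
    simp only [map_tensorPower]
    exact CState.conv_tensorPower hK φ ψ J I

lemma CQGHom.ext {G K : CompactQuantumGroup.{u}} {f g : CQGHom G K} (h : f.toHom = g.toHom) :
    f = g := by
  cases f; cases g; congr

end MatrixQuantumGroup

/-! ### Isometric actions and isometry matrices are the same data -/

section Actions

variable {Γ : Type} [Group Γ] {ι : Type} [Fintype ι] [DecidableEq ι] {B : Type u}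
  [CStarAlgebra B]

lemma wordProd_of_list (e : ι → Γ) (L : List ι) : wordProd e L.get = (L.map e).prod := by
  rw [wordProd]
  congr 1
  exact List.ext_getElem (by simp) (by simp)

lemma map_ofFn_eq {M : Type*} (f : ι → M) {r : ℕ} (J : Fin r → ι) :
    (List.ofFn J).map f = List.ofFn fun k => f (J k) := by
  rw [List.map_ofFn]; rfl

lemma wordLength_wordProd_le (e : ι → Γ) {r : ℕ} (J : Fin r → ι) :
    wordLength (Set.range e) (wordProd e J) ≤ r := by
  refine Nat.sInf_le ⟨List.ofFn fun k => e (J k), by simp, ?_, rfl⟩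
  intro x hx
  obtain ⟨k, rfl⟩ := (List.mem_ofFn' _ _).1 hx
  exact ⟨_, rfl⟩

lemma IsSymmGen.exists_wordProd_eq {e : ι → Γ} {bar : ι → ι} (he : IsSymmGen e bar) (g : Γ) :
    ∃ J : Fin (wordLength (Set.range e) g) → ι, wordProd e J = g := by
  have hne : {r | ∃ w : List Γ, w.length = r ∧ (∀ x ∈ w, x ∈ Set.range e) ∧ w.prod = g}.Nonempty := by
    obtain ⟨L, hL⟩ := he.gen g
    refine ⟨_, L.map e, rfl, fun x hx => ?_, hL⟩
    obtain ⟨I, -, rfl⟩ := List.mem_map.1 hx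
    exact ⟨I, rfl⟩
  obtain ⟨w, hw, hw', hg⟩ := Nat.sInf_mem hne
  obtain ⟨L, rfl⟩ : ∃ L : List ι, L.map e = w := by
    clear hw hg
    induction w with
    | nil => exact ⟨[], rfl⟩
    | cons x w ih =>
      obtain ⟨L, rfl⟩ := ih fun y hy => hw' y (List.mem_cons_of_mem _ hy)
      obtain ⟨I, rfl⟩ := hw' x List.mem_cons_self
      exact ⟨I :: L, rfl⟩
  change _ = wordLength (Set.range e) g at hw
  rw [List.length_map] at hw
  refine ⟨fun k => L.get (k.cast hw.symm), ?_⟩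
  refine Eq.trans ?_ hg
  rw [← wordProd_of_list]
  clear hg hw'
  generalize wordLength (Set.range e) g = m at hw
  subst hw
  rfl

lemma IsSymmGen.wordLength_gen {e : ι → Γ} {bar : ι → ι} (he : IsSymmGen e bar) (I : ι) :
    wordLength (Set.range e) (e I) = 1 := by
  have h1 := wordLength_wordProd_le e (fun _ : Fin 1 => I)
  have h2 : wordProd e (fun _ : Fin 1 => I) = e I := by simp [wordProd]
  rw [h2] at h1
  refine le_antisymm h1 (Nat.one_le_iff_ne_zero.2 fun h => ?_)
  obtain ⟨J, hJ⟩ := he.exists_wordProd_eq (e I)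
  refine he.ne_one I (hJ.symm.trans ?_)
  generalize wordLength (Set.range e) (e I) = m at h J
  subst h
  simp [wordProd]

lemma IsSymmGen.wordLength_eq_one {e : ι → Γ} {bar : ι → ι} (he : IsSymmGen e bar) {g : Γ}
    (h : wordLength (Set.range e) g = 1) : ∃ I, e I = g := by
  obtain ⟨J, hJ⟩ := he.exists_wordProd_eq g
  have key : ∀ (m : ℕ) (J : Fin m → ι), m = 1 → ∃ I, e I = wordProd e J := by
    rintro _ J rfl
    exact ⟨J 0, by simp [wordProd]⟩
  rw [← hJ]
  exact key _ J h

lemma single_eq_smul (g : Γ) (c : ℂ) :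
    MonoidAlgebra.single g c = c • MonoidAlgebra.single g (1 : ℂ) := by
  rw [MonoidAlgebra.smul_single, smul_eq_mul, mul_one]

lemma diracOp_single (S : Set Γ) (g : Γ) :
    diracOp S (MonoidAlgebra.single g 1) = (wordLength S g : ℂ) • MonoidAlgebra.single g 1 :=
  (MonoidAlgebra.basis Γ ℂ).constr_basis ℂ _ g

lemma single_mem_eigenspace (S : Set Γ) (g : Γ) :
    MonoidAlgebra.single g 1 ∈ Module.End.eigenspace (diracOp S) (wordLength S g : ℂ) :=
  Module.End.mem_eigenspace_iff.2 (diracOp_single S g)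

lemma groupCoeff_diracOp (S : Set Γ) (g : Γ) (x : MonoidAlgebra ℂ Γ) :
    groupCoeff g (diracOp S x) = wordLength S g * groupCoeff g x := by
  classical
  induction x using MonoidAlgebra.induction_linear with
  | zero => simp
  | add x y hx hy => rw [map_add, map_add, map_add, hx, hy, mul_add]
  | single h c =>
    rw [single_eq_smul, map_smul, map_smul, map_smul, diracOp_single, map_smul, groupCoeff_single]
    split_ifs with hh
    · simp [hh, mul_comm]
    · simp

lemma groupCoeff_eq_zero_of_mem_eigenspace {S : Set Γ} {t : ℂ} {x : MonoidAlgebra ℂ Γ}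
    (hx : x ∈ Module.End.eigenspace (diracOp S) t) {g : Γ} (hg : (wordLength S g : ℂ) ≠ t) :
    groupCoeff g x = 0 := by
  have h := groupCoeff_diracOp S g x
  rw [Module.End.mem_eigenspace_iff.1 hx, map_smul, smul_eq_mul] at h
  have : ((wordLength S g : ℂ) - t) * groupCoeff g x = 0 := by linear_combination -h
  exact (mul_eq_zero.1 this).resolve_left (sub_ne_zero.2 hg)

lemma mem_span_of_mem_eigenspace {S : Set Γ} {t : ℂ} {x : MonoidAlgebra ℂ Γ}
    (hx : x ∈ Module.End.eigenspace (diracOp S) t) :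
    x ∈ Submodule.span ℂ {y | ∃ g : Γ, (wordLength S g : ℂ) = t ∧
      y = MonoidAlgebra.single g (1 : ℂ)} := by
  have h : x = ∑ g ∈ x.coeff.support, groupCoeff g x • MonoidAlgebra.single g (1 : ℂ) := by
    simp only [← single_eq_smul]
    exact (MonoidAlgebra.sum_coeff_single x).symm
  rw [h]
  refine Submodule.sum_mem _ fun g _ => ?_
  by_cases hg : (wordLength S g : ℂ) = t
  · exact Submodule.smul_mem _ _ (Submodule.subset_span ⟨g, hg, rfl⟩)
  · rw [groupCoeff_eq_zero_of_mem_eigenspace hx hg, zero_smul]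
    exact zero_mem _

lemma tensorCoeff_eq_zero_of_mem_range {S : Set Γ} {t : ℂ} {y : MonoidAlgebra ℂ Γ ⊗[ℂ] B}
    (hy : y ∈ LinearMap.range ((Module.End.eigenspace (diracOp S) t).subtype.rTensor B)) {g : Γ}
    (hg : (wordLength S g : ℂ) ≠ t) : tensorCoeff B g y = 0 := by
  obtain ⟨z, rfl⟩ := hy
  induction z using TensorProduct.induction_on with
  | zero => simp
  | add x y hx hy => rw [map_add, map_add, hx, hy, add_zero]
  | tmul x b =>
    rw [LinearMap.rTensor_tmul, tensorCoeff_tmul, Submodule.subtype_apply,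
      groupCoeff_eq_zero_of_mem_eigenspace x.2 hg, zero_smul]

lemma exists_finset_sum_tensorCoeff (y : MonoidAlgebra ℂ Γ ⊗[ℂ] B) :
    ∃ s : Finset Γ, y = ∑ g ∈ s, MonoidAlgebra.single g 1 ⊗ₜ tensorCoeff B g y := by
  classical
  have h : ∃ s : Finset Γ, ∀ g ∉ s, tensorCoeff B g y = 0 := by
    induction y using TensorProduct.induction_on with
    | zero => exact ⟨∅, by simp⟩
    | add x y hx hy =>
      obtain ⟨s, hs⟩ := hx
      obtain ⟨t, ht⟩ := hy
      refine ⟨s ∪ t, fun g hg => ?_⟩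
      rw [Finset.mem_union, not_or] at hg
      rw [map_add, hs g hg.1, ht g hg.2, add_zero]
    | tmul x b =>
      refine ⟨x.coeff.support, fun g hg => ?_⟩
      rw [tensorCoeff_tmul, show groupCoeff g x = 0 from Finsupp.notMem_support_iff.1 hg, zero_smul]
  obtain ⟨s, hs⟩ := h
  refine ⟨s, tensorCoeff_ext fun g => ?_⟩
  rw [map_sum]
  simp only [tensorCoeff_single_tmul, Finset.sum_ite_eq']
  split_ifs with hg
  · rfl
  · exact hs g hg

section OfMatrix

variable {e : ι → Γ} {bar : ι → ι} {v : Matrix ι ι B} (hv : IsIsometryMatrix e bar v)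
  (he : IsSymmGen e bar)
include hv he

lemma IsIsometryMatrix.coact_wordProd {r : ℕ} (I : Fin r → ι) :
    hv.coact he (MonoidAlgebra.single (wordProd e I) 1) =
      ∑ J : Fin r → ι, MonoidAlgebra.single (wordProd e J) 1 ⊗ₜ tensorPower v r J I := by
  have := hv.coact_prod he (List.ofFn I)
  rw [map_ofFn_eq, map_ofFn_eq, prod_coactGen] at this
  exact this

/-- Orthonormal rows invert the coaction on words of a fixed length. Both totality of the action and
invariance of the eigenspaces rest on this. -/
lemma IsIsometryMatrix.single_tmul_eq {r : ℕ} (J : Fin r → ι) (b : B) :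
    MonoidAlgebra.single (wordProd e J) 1 ⊗ₜ b = ∑ I : Fin r → ι,
      hv.coact he (MonoidAlgebra.single (wordProd e I) 1) *
        (1 ⊗ₜ (star (tensorPower v r J I) * b)) := by
  simp only [hv.coact_wordProd he, Finset.sum_mul, Algebra.TensorProduct.tmul_mul_tmul, mul_one]
  rw [Finset.sum_comm]
  simp only [← TensorProduct.tmul_sum, ← mul_assoc, ← Finset.sum_mul, tensorPower_row hv.row]
  rw [Finset.sum_eq_single J]
  · simp
  · intro K _ hK; rw [if_neg hK, zero_mul, TensorProduct.tmul_zero]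
  · simp

/-- The coaction preserves the word length. -/
lemma IsIsometryMatrix.tensorCoeff_coact_eq_zero {g h : Γ}
    (hgh : wordLength (Set.range e) h ≠ wordLength (Set.range e) g) :
    tensorCoeff B h (hv.coact he (MonoidAlgebra.single g 1)) = 0 := by
  classical
  rcases lt_or_gt_of_ne hgh with hlt | hlt
  -- If `h` is shorter than `g`, write the coefficient as the trace of `(h ⊗ 1)* α(g)` and expand `h
  -- ⊗ 1` through images of words of length `l(h)`. None of these words represents `g`, so trace
  -- invariance kills every term.
  · obtain ⟨J, hJ⟩ := he.exists_wordProd_eq h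
    have h1 : (MonoidAlgebra.single h⁻¹ 1 ⊗ₜ[ℂ] 1 : MonoidAlgebra ℂ Γ ⊗[ℂ] B) =
        star (MonoidAlgebra.single h 1 ⊗ₜ[ℂ] 1) := by
      rw [TensorProduct.star_tmul, groupAlgebra_star_single, star_one, star_one]
    rw [tensorCoeff_eq_single_mul, h1, ← hJ, hv.single_tmul_eq he, star_sum, Finset.sum_mul,
      map_sum]
    refine Finset.sum_eq_zero fun I _ => ?_
    rw [star_mul, TensorProduct.star_tmul, star_one, ← map_star, mul_assoc, ← map_mul,
      tensorCoeff_tmul_mul, hv.tensorCoeff_one_coact he, groupAlgebra_star_single,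
      MonoidAlgebra.single_mul_single, groupCoeff_single, if_neg, zero_smul, mul_zero]
    intro h2
    rw [inv_mul_eq_one] at h2
    have := wordLength_wordProd_le e I
    rw [h2] at this
    omega
  -- If `h` is longer than `g`, it is not a word of length `l(g)` and does not occur in the
  -- expansion of `α(g)`.
  · obtain ⟨I, hI⟩ := he.exists_wordProd_eq g
    conv_lhs => rw [← hI]
    rw [hv.coact_wordProd he, map_sum]
    refine Finset.sum_eq_zero fun J _ => ?_
    rw [tensorCoeff_single_tmul, if_neg]
    rintro rfl
    have := wordLength_wordProd_le e J
    omega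

end OfMatrix

/-- The isometric action associated to an isometry matrix which is a corepresentation. -/
def IsometricAction.ofMatrix {e : ι → Γ} {bar : ι → ι} (he : IsSymmGen e bar)
    {G : CompactQuantumGroup.{u}} {v : Matrix ι ι G.alg} (hv : IsIsometryMatrix e bar v)
    (hΔ : ∀ J I, G.comul (v J I) = matrixTensor v v J I) : IsometricAction (Set.range e) G where
  coact := hv.coact he
  coassoc x := by
    induction x using MonoidAlgebra.induction_linear with
    | zero => simp
    | add x y hx hy => simp only [map_add, hx, hy]
    | single g c =>
      rw [single_eq_smul]
      simp only [map_smul]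
      congr 1
      obtain ⟨r, I, rfl⟩ : ∃ (r : ℕ) (I : Fin r → ι), wordProd e I = g := ⟨_, he.exists_wordProd_eq g⟩
      rw [hv.coact_wordProd he]
      have h1 : ∀ J : Fin r → ι, (hv.coact he).toAlgHom.toLinearMap
          (MonoidAlgebra.single (wordProd e J) 1) =
          ∑ K : Fin r → ι, MonoidAlgebra.single (wordProd e K) 1 ⊗ₜ tensorPower v r K J :=
        fun J => hv.coact_wordProd he J
      have h2 : ∀ J : Fin r → ι, G.comul.toAlgHom.toLinearMap (tensorPower v r J I) =
          ∑ K, MinTensor.tmul (tensorPower v r J K) (tensorPower v r K I) :=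
        fun J => comul_tensorPower hΔ J I
      simp only [map_sum, LinearMap.rTensor_tmul, LinearMap.lTensor_tmul, h1, h2,
        TensorProduct.sum_tmul, TensorProduct.tmul_sum, TensorProduct.assoc_tmul,
        MinTensor.ofTensor_tmul]
      exact Finset.sum_comm
  total := by
    rw [eq_top_iff, ← TensorProduct.span_tmul_eq_top, Submodule.span_le]
    rintro _ ⟨x, b, rfl⟩
    induction x using MonoidAlgebra.induction_linear with
    | zero => rw [TensorProduct.zero_tmul]; exact zero_mem _
    | add x y hx hy => rw [TensorProduct.add_tmul]; exact add_mem hx hy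
    | single g c =>
      rw [single_eq_smul, ← TensorProduct.smul_tmul']
      refine Submodule.smul_mem _ _ ?_
      obtain ⟨J, hJ⟩ := he.exists_wordProd_eq g
      rw [← hJ, hv.single_tmul_eq he]
      exact Submodule.sum_mem _ fun I _ => Submodule.subset_span ⟨_, _, rfl⟩
  map_eigenspace t x hx := by
    have h := mem_span_of_mem_eigenspace hx
    clear hx
    induction h using Submodule.span_induction with
    | zero => rw [map_zero]; exact zero_mem _
    | add x y _ _ hx hy => rw [map_add]; exact add_mem hx hy
    | smul c x _ hx => rw [map_smul]; exact Submodule.smul_mem _ _ hx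
    | mem x h =>
      obtain ⟨g, rfl, rfl⟩ := h
      obtain ⟨s, hs⟩ := exists_finset_sum_tensorCoeff (hv.coact he (MonoidAlgebra.single g 1))
      rw [hs]
      refine Submodule.sum_mem _ fun h _ => ?_
      by_cases hh : wordLength (Set.range e) h = wordLength (Set.range e) g
      · refine ⟨⟨MonoidAlgebra.single h 1, ?_⟩ ⊗ₜ _, rfl⟩
        rw [← hh]
        exact single_mem_eigenspace _ h
      · rw [hv.tensorCoeff_coact_eq_zero he hh, TensorProduct.tmul_zero]
        exact zero_mem _
  map_trace := hv.tensorCoeff_one_coact he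

/-- The matrix of the action on the span of the generators. -/
def IsometricAction.matrix {S : Set Γ} {G : CompactQuantumGroup.{u}} (α : IsometricAction S G)
    (e : ι → Γ) : Matrix ι ι G.alg :=
  fun J I => tensorCoeff G.alg (e J) (α.coact (MonoidAlgebra.single (e I) 1))

lemma IsometricAction.matrix_ofMatrix {e : ι → Γ} {bar : ι → ι} (he : IsSymmGen e bar)
    {G : CompactQuantumGroup.{u}} {v : Matrix ι ι G.alg} (hv : IsIsometryMatrix e bar v)
    (hΔ : ∀ J I, G.comul (v J I) = matrixTensor v v J I) :
    (IsometricAction.ofMatrix he hv hΔ).matrix e = v := by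
  ext J I
  change tensorCoeff G.alg (e J) (hv.coact he _) = _
  rw [hv.coact_gen he, tensorCoeff_coactGen he.inj]

lemma tensorCoeff_star (g : Γ) (y : MonoidAlgebra ℂ Γ ⊗[ℂ] B) :
    tensorCoeff B g⁻¹ (star y) = star (tensorCoeff B g y) := by
  classical
  induction y using TensorProduct.induction_on with
  | zero => simp
  | add x y hx hy => simp only [star_add, map_add, hx, hy]
  | tmul x b =>
    induction x using MonoidAlgebra.induction_linear with
    | zero => simp
    | add x y hx hy => simp only [TensorProduct.add_tmul, star_add, map_add, hx, hy]
    | single h c =>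
      rw [TensorProduct.star_tmul, groupAlgebra_star_single, tensorCoeff_tmul, tensorCoeff_tmul,
        groupCoeff_single, groupCoeff_single, star_smul]
      simp only [inv_inj]
      split_ifs <;> simp

namespace IsometricAction

variable {e : ι → Γ} {bar : ι → ι} (he : IsSymmGen e bar) {G : CompactQuantumGroup.{u}}
  (β : IsometricAction (Set.range e) G)
include he

lemma tensorCoeff_eq_zero_of_wordLength_ne {g h : Γ}
    (hgh : wordLength (Set.range e) h ≠ wordLength (Set.range e) g) :
    tensorCoeff G.alg h (β.coact (MonoidAlgebra.single g 1)) = 0 :=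
  tensorCoeff_eq_zero_of_mem_range (β.map_eigenspace _ _ (single_mem_eigenspace _ g))
    (by exact_mod_cast hgh)

/-- The elements of length 1 are exactly the generators, and the eigenspace they span is invariant.
-/
lemma coact_gen (I : ι) : β.coact (MonoidAlgebra.single (e I) 1) = coactGen e (β.matrix e) I := by
  classical
  refine tensorCoeff_ext fun h => ?_
  by_cases hh : wordLength (Set.range e) h = 1
  · obtain ⟨J, rfl⟩ := he.wordLength_eq_one hh
    rw [tensorCoeff_coactGen he.inj]
    rfl
  · rw [β.tensorCoeff_eq_zero_of_wordLength_ne he (by rwa [he.wordLength_gen]), coactGen, map_sum]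
    refine (Finset.sum_eq_zero fun J _ => ?_).symm
    rw [tensorCoeff_single_tmul, if_neg]
    rintro rfl
    exact hh (he.wordLength_gen J)

lemma coact_prod (L : List ι) : β.coact (MonoidAlgebra.single (L.map e).prod 1) =
    (L.map (coactGen e (β.matrix e))).prod := by
  induction L with
  | nil => exact map_one β.coact
  | cons I L ih =>
    have : MonoidAlgebra.single ((I :: L).map e).prod (1 : ℂ) =
        MonoidAlgebra.single (e I) 1 * MonoidAlgebra.single (L.map e).prod 1 := by
      rw [MonoidAlgebra.single_mul_single, mul_one, List.map_cons, List.prod_cons]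
    rw [this, map_mul, ih, β.coact_gen he, List.map_cons, List.prod_cons]

lemma star_matrix (J I : ι) : star (β.matrix e J I) = β.matrix e (bar J) (bar I) := by
  rw [matrix, ← tensorCoeff_star, ← map_star, groupAlgebra_star_single, star_one, ← he.inv,
    ← he.inv]
  rfl

open Matrix in
-- The entries of the left side are the traces of the images of `e_K⁻¹ e_L`.
lemma conjTranspose_mul_matrix : (β.matrix e)ᴴ * β.matrix e = 1 := by
  classical
  ext K L
  have h : ((β.matrix e)ᴴ * β.matrix e) K L =
      ∑ J, β.matrix e J (bar K) * β.matrix e (bar J) L := by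
    simp only [Matrix.mul_apply, Matrix.conjTranspose_apply, β.star_matrix he]
    rw [← Function.Involutive.bijective he.bar_bar |>.sum_comp]
    simp only [he.bar_bar]
  rw [h, ← he.tensorCoeff_one_mul, ← β.coact_gen he, ← β.coact_gen he, ← map_mul, β.map_trace,
    MonoidAlgebra.single_mul_single, groupCoeff_single, he.mul_eq_one_iff, he.bar_bar,
    Matrix.one_apply]
  simp only [eq_comm (a := L)]
  split_ifs <;> simp

/-- Trace invariance alone makes the matrix only an isometry. Totality gives the right inverse:
expand `e_K ⊗ 1` in elements `α(x)(1 ⊗ b)` and keep the coefficients at generators, to which only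
the part of `x` of length 1 contributes. -/
lemma exists_matrix_mul_eq_one : ∃ w : Matrix ι ι G.alg, β.matrix e * w = 1 := by
  classical
  have h : ∀ y : MonoidAlgebra ℂ Γ ⊗[ℂ] G.alg, ∃ c : ι → G.alg, ∀ J,
      tensorCoeff G.alg (e J) y = ∑ I, β.matrix e J I * c I := fun y => by
    have hy : y ∈ Submodule.span ℂ {y | ∃ x b, y = β.coact x * (1 ⊗ₜ[ℂ] b)} := by
      rw [β.total]; trivial
    induction hy using Submodule.span_induction with
    | zero => exact ⟨0, by simp⟩
    | add x y _ _ hx hy =>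
      obtain ⟨c, hc⟩ := hx
      obtain ⟨d, hd⟩ := hy
      exact ⟨c + d, fun J => by simp [hc, hd, mul_add, Finset.sum_add_distrib]⟩
    | smul a x _ hx =>
      obtain ⟨c, hc⟩ := hx
      exact ⟨a • c, fun J => by simp [hc, Finset.smul_sum]⟩
    | mem y hy =>
      obtain ⟨x, b, rfl⟩ := hy
      induction x using MonoidAlgebra.induction_linear with
      | zero => exact ⟨0, by simp⟩
      | add x y hx hy =>
        obtain ⟨c, hc⟩ := hx
        obtain ⟨d, hd⟩ := hy
        exact ⟨c + d, fun J => by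
          simp only [map_add, add_mul, hc, hd, Pi.add_apply, mul_add, Finset.sum_add_distrib]⟩
      | single g a =>
        by_cases hg : wordLength (Set.range e) g = 1
        · obtain ⟨I, rfl⟩ := he.wordLength_eq_one hg
          refine ⟨Pi.single I (a • b), fun J => ?_⟩
          rw [single_eq_smul, map_smul, smul_mul_assoc, map_smul, tensorCoeff_mul_tmul,
            Finset.sum_eq_single I]
          · simp [matrix]
          · intro K _ hK; simp [hK]
          · simp
        · refine ⟨0, fun J => ?_⟩
          rw [single_eq_smul, map_smul, smul_mul_assoc, map_smul, tensorCoeff_mul_tmul,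
            β.tensorCoeff_eq_zero_of_wordLength_ne he (by rw [he.wordLength_gen]; exact Ne.symm hg)]
          simp
  choose c hc using fun K : ι => h (MonoidAlgebra.single (e K) 1 ⊗ₜ 1)
  refine ⟨Matrix.of fun I K => c K I, ?_⟩
  ext J K
  simp only [Matrix.mul_apply, Matrix.of_apply]
  rw [← hc, tensorCoeff_single_tmul, Matrix.one_apply]
  simp only [he.inj.eq_iff, eq_comm]

/-- The matrix of an isometric action is an isometry matrix. -/
lemma isIsometryMatrix : IsIsometryMatrix e bar (β.matrix e) where
  rel L h := by rw [← β.coact_prod he, h]; exact map_one β.coact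
  trace L h := by
    classical
    rw [← β.coact_prod he, β.map_trace, groupCoeff_single, if_neg h, zero_smul]
  star_apply := β.star_matrix he
  row K L := by
    obtain ⟨w, hw⟩ := β.exists_matrix_mul_eq_one he
    -- The adjoint is a left inverse, hence equals the right inverse; this is row orthonormality.
    have h := left_inv_eq_right_inv (β.conjTranspose_mul_matrix he) hw
    rw [← h] at hw
    have := congrFun (congrFun hw K) L
    rw [Matrix.mul_apply, Matrix.one_apply] at this
    exact this

lemma comul_matrix (J I : ι) :
    G.comul (β.matrix e J I) = matrixTensor (β.matrix e) (β.matrix e) J I := by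
  classical
  have h := congrArg (tensorCoeff (MinTensor G.alg G.alg) (e J))
    (β.coassoc (MonoidAlgebra.single (e I) 1))
  rw [β.coact_gen he, coactGen] at h
  have h1 : ∀ K : ι, β.coact.toAlgHom.toLinearMap (MonoidAlgebra.single (e K) 1) =
      ∑ L, MonoidAlgebra.single (e L) 1 ⊗ₜ β.matrix e L K := fun K => β.coact_gen he K
  simp only [map_sum, LinearMap.rTensor_tmul, LinearMap.lTensor_tmul, h1, TensorProduct.sum_tmul,
    TensorProduct.assoc_tmul, MinTensor.ofTensor_tmul, tensorCoeff_single_tmul, he.inj.eq_iff,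
    Finset.sum_ite_eq', Finset.mem_univ, if_true] at h
  exact h.symm

/-- Two actions whose matrices correspond under `f` are related by `f`. -/
lemma coact_eq_lTensor {K : CompactQuantumGroup.{u}} (γ : IsometricAction (Set.range e) K)
    (f : G.alg →⋆ₐ[ℂ] K.alg) (hf : (β.matrix e).map f = γ.matrix e) (x : MonoidAlgebra ℂ Γ) :
    γ.coact x = f.toAlgHom.toLinearMap.lTensor (MonoidAlgebra ℂ Γ) (β.coact x) := by
  let φ : MonoidAlgebra ℂ Γ →⋆ₐ[ℂ] MonoidAlgebra ℂ Γ ⊗[ℂ] K.alg :=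
    { (mapCoeff Γ f).comp β.coact.toAlgHom with
      map_star' := fun x => by
        change mapCoeff Γ f (β.coact (star x)) = star (mapCoeff Γ f (β.coact x))
        rw [map_star, mapCoeff_star] }
  refine he.hom_ext (α := γ.coact) (β := φ) (fun I => ?_) x
  change _ = mapCoeff Γ f (β.coact (MonoidAlgebra.single (e I) 1))
  rw [γ.coact_gen he, β.coact_gen he, mapCoeff_coactGen, hf]

omit he in
lemma map_matrix_eq {K : CompactQuantumGroup.{u}} (γ : IsometricAction (Set.range e) K)
    (f : G.alg →⋆ₐ[ℂ] K.alg)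
    (hf : ∀ x, γ.coact x = f.toAlgHom.toLinearMap.lTensor (MonoidAlgebra ℂ Γ) (β.coact x))
    (J I : ι) : f (β.matrix e J I) = γ.matrix e J I := by
  rw [matrix, matrix, hf, ← mapCoeff_eq_lTensor, tensorCoeff_mapCoeff]

end IsometricAction

/-- An action with universal matrix is the universal isometric action. -/
lemma IsUniversalMatrix.isQuantumIsometryGroup {e : ι → Γ} {bar : ι → ι} (he : IsSymmGen e bar)
    {G : CompactQuantumGroup.{u}} (α : IsometricAction (Set.range e) G)
    (h : IsUniversalMatrix e bar (α.matrix e)) :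
    IsQuantumIsometryGroup (Set.range e) G α := by
  intro K β
  obtain ⟨f, hf⟩ := h.exists_hom K.alg (β.matrix e) (β.isIsometryMatrix he)
  have hf' : (α.matrix e).map f = β.matrix e := Matrix.ext hf
  refine ⟨CQGHom.ofMatrix (α.matrix e) h.dense (α.comul_matrix he) f fun J I => ?_,
    fun x => α.coact_eq_lTensor he β f hf' x, fun g hg => CQGHom.ext ?_⟩
  · rw [hf', hf]
    exact β.comul_matrix he J I
  · refine starAlgHom_ext_of_dense h.dense fun J I => ?_
    rw [α.map_matrix_eq β g.toHom hg J I]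
    exact (hf J I).symm

/-- The quantum isometry group exists, and its matrix is the universal one. -/
theorem IsSymmGen.exists_quantumIsometryGroup {e : ι → Γ} {bar : ι → ι} (he : IsSymmGen e bar) :
    ∃ (G : CompactQuantumGroup.{u}) (α : IsometricAction (Set.range e) G),
      IsUniversalMatrix e bar (α.matrix e) := by
  obtain ⟨A, _, _, v, hv⟩ := exists_isUniversalMatrix.{u} he
  obtain ⟨Δ, hΔ⟩ := hv.exists_hom _ _ (hv.isometry.matrixTensor he hv.isometry)
  let G : CompactQuantumGroup.{u} := CompactQuantumGroup.ofMatrix v Δ hΔ hv.dense hv.isometry.row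
    (hv.isometry.column he)
  refine ⟨G, IsometricAction.ofMatrix (G := G) he hv.isometry hΔ, ?_⟩
  exact (congrArg (IsUniversalMatrix (A := G.alg) e bar)
    (IsometricAction.matrix_ofMatrix (G := G) he hv.isometry hΔ)).mpr hv

/-- The composition of morphisms. -/
def CQGHom.comp {G K L : CompactQuantumGroup.{u}} (g : CQGHom K L) (f : CQGHom G K) :
    CQGHom G L where
  toHom := g.toHom.comp f.toHom
  map_comul φ ψ := by
    have h := congrArg (fun χ => χ.comp f.toHom) (g.map_comul φ ψ)
    exact h.trans (f.map_comul _ _)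

/-- The identity morphism. -/
def CQGHom.id (G : CompactQuantumGroup.{u}) : CQGHom G G where
  toHom := StarAlgHom.id ℂ G.alg
  map_comul φ ψ := by
    have h : ∀ χ : CState G.alg, χ.comp (StarAlgHom.id ℂ G.alg) = χ := fun χ =>
      CState.ext fun _ => rfl
    rw [h, h, h]

/-- The matrix of the quantum isometry group is universal. -/
theorem IsQuantumIsometryGroup.isUniversalMatrix {e : ι → Γ} {bar : ι → ι}
    (he : IsSymmGen e bar) {G : CompactQuantumGroup.{u}} {α : IsometricAction (Set.range e) G}
    (h : IsQuantumIsometryGroup (Set.range e) G α) : IsUniversalMatrix e bar (α.matrix e) := by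
  obtain ⟨G₀, α₀, h₀⟩ := he.exists_quantumIsometryGroup.{u}
  obtain ⟨f, hf, -⟩ := h G₀ α₀
  obtain ⟨g, hg, -⟩ := h₀.isQuantumIsometryGroup he α₀ G α
  have hf' := α.map_matrix_eq α₀ f.toHom hf
  have hg' := α₀.map_matrix_eq α g.toHom hg
  -- Both morphisms carry `α` to itself, so the uniqueness in the universal property applies. It
  -- makes `g` surjective, and density of polynomials passes from `G₀` to `G`.
  have hgf : g.comp f = CQGHom.id G := by
    refine (h G α).unique (fun x => α.coact_eq_lTensor he α _ (Matrix.ext fun J I => ?_) x)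
      (fun x => α.coact_eq_lTensor he α _ rfl x)
    change g.toHom (f.toHom (α.matrix e J I)) = _
    rw [hf', hg']
  have hsurj : Function.Surjective g.toHom := fun a =>
    ⟨f.toHom a, DFunLike.congr_fun (congrArg CQGHom.toHom hgf) a⟩
  refine ⟨α.isIsometryMatrix he, ?_, fun B _ w hw => ?_⟩
  · have hd := hsurj.denseRange.comp h₀.dense g.toHom.continuous_of_cstar
    have : g.toHom ∘ evalMatrix (α₀.matrix e) = evalMatrix (α.matrix e) := by
      ext x
      rw [Function.comp_apply, map_evalMatrix]
      exact congrArg (fun v => evalMatrix v x) (Matrix.ext hg')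
    rwa [this] at hd
  · obtain ⟨k, hk⟩ := h₀.exists_hom B w hw
    exact ⟨k.comp f.toHom, fun J I => by rw [StarAlgHom.comp_apply, hf', hk]⟩

end Actions

/-! ### Groups with long relators and the cubic relations -/

section DehnPresentation

variable {Γ : Type} [Group Γ] {ι : Type} [Fintype ι] [DecidableEq ι] {B : Type u}
  [CStarAlgebra B]

/-- The product `v_{J_1I_1} ⋯ v_{J_rI_r}` for two words of the same length. -/
def pairProd (v : Matrix ι ι B) (L M : List ι) : B := (List.zipWith (fun J I => v J I) L M).prod

lemma pairProd_append (v : Matrix ι ι B) {L L' M M' : List ι} (h : L.length = M.length) :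
    pairProd v (L ++ L') (M ++ M') = pairProd v L M * pairProd v L' M' := by
  rw [pairProd, List.zipWith_append h, List.prod_append]
  rfl

lemma pairProd_ofFn (v : Matrix ι ι B) {r : ℕ} (J I : Fin r → ι) :
    pairProd v (List.ofFn J) (List.ofFn I) = tensorPower v r J I := by
  rw [pairProd, tensorPower]
  congr 1
  exact List.ext_getElem (by simp) (by simp)

/-- The words `J · bar J`. -/
def cancelWords (bar : ι → ι) : Set (List ι) := {w | ∃ J, w = [J, bar J]}

/-- A set `T` of relators, containing the words `J · bar J` and otherwise only words of length at
least `5`, such that each nonempty word representing `1` contains a subword in `T`. -/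
structure IsDehnPresentation (e : ι → Γ) (bar : ι → ι) (T : Set (List ι)) : Prop where
  cancel_subset : cancelWords bar ⊆ T
  length_le : ∀ w ∈ T, w ∈ cancelWords bar ∨ 5 ≤ w.length
  prod_eq_one : ∀ w ∈ T, (w.map e).prod = 1
  prod_ne_one : ∀ L : List ι, L ≠ [] → (∀ w ∈ T, ¬ w <:+: L) → (L.map e).prod ≠ 1

namespace IsDehnPresentation

variable {e : ι → Γ} {bar : ι → ι} {T : Set (List ι)} (hT : IsDehnPresentation e bar T)
include hT

/-- Relators other than cancellations are too long to fit into such a word. For the cyclic groups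
this is where `s ≥ 5` enters. -/
lemma prod_ne_one_of_isChain {L : List ι} (h : L ≠ []) (hl : L.length ≤ 4)
    (hc : L.IsChain fun I J => J ≠ bar I) : (L.map e).prod ≠ 1 := by
  refine hT.prod_ne_one L h fun w hw hwL => ?_
  rcases hT.length_le w hw with ⟨J, rfl⟩ | h5
  · simpa using hc.infix hwL
  · have := hwL.length_le
    omega

lemma mul_bar (J : ι) : e J * e (bar J) = 1 := by
  simpa using hT.prod_eq_one [J, bar J] (hT.cancel_subset ⟨J, rfl⟩)

lemma inv_bar (J : ι) : e (bar J) = (e J)⁻¹ := eq_inv_of_mul_eq_one_right (hT.mul_bar J)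

lemma isSymmGen (hbar : ∀ I, bar (bar I) = I) (gen : ∀ g, ∃ L : List ι, (L.map e).prod = g) :
    IsSymmGen e bar where
  bar_bar := hbar
  inv := hT.inv_bar
  inj J K h := by
    by_contra hJK
    refine hT.prod_ne_one_of_isChain (L := [bar J, K]) (by simp) (by simp) ?_ ?_
    · simpa [hbar] using Ne.symm hJK
    · simp [hT.inv_bar, h]
  gen := gen
  ne_one I := by
    have := hT.prod_ne_one_of_isChain (L := [I]) (by simp) (by simp) (by simp)
    simpa using this

/-- Otherwise one of the words `J'⁻¹JKK'⁻¹`, `J'⁻¹J`, `KK'⁻¹` would be a word without cancellations,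
of length at most 4, representing 1. The bound on relators matters: in `ℤ_4` one has `g g = g⁻¹
g⁻¹`. -/
lemma eq_of_mul_eq_mul (hbar : ∀ I, bar (bar I) = I) {J K J' K' : ι} (hK : K ≠ bar J)
    (h : e J * e K = e J' * e K') : J = J' ∧ K = K' := by
  have h1 : (e J')⁻¹ * e J * e K * (e K')⁻¹ = 1 := by
    rw [mul_assoc _ (e J), h]; group
  by_cases hJ : J = J'
  · refine ⟨hJ, ?_⟩
    subst hJ
    by_contra hK'
    refine hT.prod_ne_one_of_isChain (L := [K, bar K']) (by simp) (by simp) ?_ ?_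
    · simp only [List.isChain_cons_cons, List.isChain_singleton, and_true]
      exact fun h => hK' (by rw [← hbar K, ← h, hbar])
    · simpa [hT.inv_bar] using h1
  · by_cases hK' : K = K'
    · subst hK'
      exact absurd (mul_right_cancel h)
        fun h => hT.prod_ne_one_of_isChain (L := [bar J', J]) (by simp) (by simp)
          (by simpa [hbar] using hJ) (by simp [hT.inv_bar, h])
    · exfalso
      refine hT.prod_ne_one_of_isChain (L := [bar J', J, K, bar K']) (by simp) (by simp) ?_ ?_
      · simp only [List.isChain_cons_cons, List.isChain_singleton, and_true, hbar]
        exact ⟨hJ, hK, fun h => hK' (by rw [← hbar K, ← h, hbar])⟩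
      · simpa [hT.inv_bar, mul_assoc] using h1

/-- For a Dehn presentation, the relations of an isometry matrix may be tested on the relators. -/
lemma isIsometryMatrix {v : Matrix ι ι B}
    (hstar : ∀ J I, star (v J I) = v (bar J) (bar I))
    (hrow : ∀ K L, ∑ I, v K I * star (v L I) = if K = L then 1 else 0)
    (hrel : ∀ w ∈ T, (w.map (coactGen e v)).prod = 1)
    (hzero : ∀ w ∈ T, ∀ w' : List ι, w.length = w'.length → w' ∉ T →
      pairProd v w w' = 0) : IsIsometryMatrix e bar v := by
  classical
  have key : ∀ (N : ℕ) (L : List ι), L.length = N →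
      ((L.map e).prod = 1 → (L.map (coactGen e v)).prod = 1) ∧
      ((L.map e).prod ≠ 1 → tensorCoeff B 1 (L.map (coactGen e v)).prod = 0) := fun N => by
    induction N using Nat.strong_induction_on with | _ N ih =>
    rintro L rfl
    by_cases hL : ∃ w ∈ T, w <:+: L
    -- A relator inside `L` can be deleted without changing either the group element or the image,
    -- which leaves a shorter word.
    · obtain ⟨w, hw, s, t, rfl⟩ := hL
      have hlen : 0 < w.length := by
        rcases hT.length_le w hw with ⟨J, rfl⟩ | h
        · simp
        · omega
      have := ih (s ++ t).length (by simp; omega) (s ++ t) rfl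
      simpa [hrel w hw, hT.prod_eq_one w hw] using this
    · push Not at hL
      by_cases hnil : L = []
      · subst hnil; simp
      have hne := hT.prod_ne_one L hnil hL
      refine ⟨fun h => absurd h hne, fun _ => ?_⟩
      have hprod : (L.map (coactGen e v)).prod = ∑ J : Fin L.length → ι,
          MonoidAlgebra.single (wordProd e J) 1 ⊗ₜ tensorPower v L.length J L.get := by
        rw [← prod_coactGen, ← map_ofFn_eq, List.ofFn_get]
      rw [hprod, map_sum]
      refine Finset.sum_eq_zero fun J _ => ?_
      rw [tensorCoeff_single_tmul]
      split_ifs with hJ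
      swap; · rfl
      have hz : tensorPower v L.length J L.get = pairProd v (List.ofFn J) L := by
        rw [← pairProd_ofFn, List.ofFn_get]
      have hJL : (List.ofFn J).length = L.length := List.length_ofFn
      have hJ1 : ((List.ofFn J).map e).prod = 1 := by rw [map_ofFn_eq]; exact hJ
      -- Now `L` contains no relator, whereas a word `J` contributing to the trace must contain one.
      -- It faces a subword of `L` that is not a relator, so `hzero` kills the term.
      obtain ⟨w, hw, s, t, hst⟩ : ∃ w ∈ T, w <:+: List.ofFn J := by
        by_contra hcon
        push Not at hcon
        refine hT.prod_ne_one _ (fun h => hnil ?_) hcon hJ1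
        rw [h] at hJL
        exact List.length_eq_zero_iff.1 hJL.symm
      rw [hz]
      rw [← hst] at hJL ⊢
      simp only [List.length_append] at hJL
      obtain ⟨a, b, c, rfl, ha, hb⟩ : ∃ a b c, L = a ++ b ++ c ∧ s.length = a.length ∧
          w.length = b.length := by
        refine ⟨L.take s.length, (L.drop s.length).take w.length,
          (L.drop s.length).drop w.length, ?_, ?_, ?_⟩
        · rw [List.append_assoc, List.take_append_drop, List.take_append_drop]
        · simp; omega
        · simp; omega
      rw [pairProd_append v (by simp; omega), pairProd_append v ha, hzero w hw b hb fun hbT => hL b hbT ⟨a, c, rfl⟩, mul_zero, zero_mul]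
  exact ⟨fun L => (key _ L rfl).1, fun L => (key _ L rfl).2, hstar, hrow⟩

end IsDehnPresentation

/-- The relations of `H_{n0}^+` on a matrix `v`: it is compatible with the involution, and the
entries on each row and column are partial isometries with orthogonal supports and orthogonal
ranges summing up to `1`. -/
structure IsCubicMatrix (bar : ι → ι) (v : Matrix ι ι B) : Prop where
  star_apply : ∀ J I, star (v J I) = v (bar J) (bar I)
  row_orth : ∀ J I K, I ≠ K → star (v J I) * v J K = 0
  col_orth : ∀ J K I, J ≠ K → star (v J I) * v K I = 0
  row_sum : ∀ J, ∑ I, v J I * star (v J I) = 1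
  col_sum : ∀ I, ∑ J, v J I * star (v J I) = 1

namespace IsCubicMatrix

variable {bar : ι → ι} (hbar : ∀ I, bar (bar I) = I) {v : Matrix ι ι B}

/-- For `J ≠ K`, the coefficient of `e_J e_K⁻¹` in `α(e_I)α(e_I⁻¹) = 1` reduces, by uniqueness of
the two factors, to the single term `v_{JI} v_{KI}*`, which is therefore 0. Inversion gives the
other column relation, and the column sums then make the entries partial isometries. On a row, the
range projections sum up to 1 and so are orthogonal. -/
lemma of_isIsometryMatrix {e : ι → Γ} {T : Set (List ι)} (he : IsSymmGen e bar)
    (hT : IsDehnPresentation e bar T) (hv : IsIsometryMatrix e bar v) : IsCubicMatrix bar v := by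
  classical
  have hb := he.bar_bar
  have hcol' : ∀ J K I, J ≠ K → v J I * star (v K I) = 0 := fun J K I hJK => by
    rw [hv.star_apply]
    have hne : bar K ≠ bar J := fun h => hJK (he.bar_injective h).symm
    have h := congrArg (tensorCoeff B (e J * e (bar K))) (hv.rel [I, bar I] (by simp [he.mul_bar]))
    simp only [List.map_cons, List.map_nil, List.prod_cons, List.prod_nil, mul_one] at h
    rw [coactGen, coactGen, Finset.sum_mul_sum, Algebra.TensorProduct.one_def,
      MonoidAlgebra.one_def, tensorCoeff_single_tmul, if_neg] at h
    · simp only [Algebra.TensorProduct.tmul_mul_tmul, MonoidAlgebra.single_mul_single, mul_one,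
        map_sum, tensorCoeff_single_tmul] at h
      rw [Finset.sum_eq_single J, Finset.sum_eq_single (bar K), if_pos rfl] at h
      · exact h
      · intro M _ hM
        rw [if_neg]
        exact fun h => hM (hT.eq_of_mul_eq_mul hb hne h.symm).2.symm
      · simp
      · intro M _ hM
        refine Finset.sum_eq_zero fun N _ => ?_
        rw [if_neg]
        exact fun h => hM (hT.eq_of_mul_eq_mul hb hne h.symm).1.symm
      · simp
    · exact fun h => hne ((he.mul_eq_one_iff _ _).1 h.symm)
  have hcol : ∀ J K I, J ≠ K → star (v J I) * v K I = 0 := fun J K I hJK => by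
    have := hcol' (bar J) (bar K) (bar I) fun h => hJK (he.bar_injective h)
    rwa [hv.star_apply, hb, hb, ← hv.star_apply] at this
  have hcs : ∀ I, ∑ J, v J I * star (v J I) = 1 := fun I => by
    rw [hv.column he, if_pos rfl]
  have hrs : ∀ J, ∑ I, v J I * star (v J I) = 1 := fun J => by
    rw [hv.row, if_pos rfl]
  have hpi : ∀ J I, v J I * star (v J I) * v J I = v J I := fun J I => by
    have h := congrArg (· * v J I) (hcs I)
    simp only [one_mul, Finset.sum_mul] at h
    rwa [Finset.sum_eq_single J] at h
    · intro K _ hK; rw [mul_assoc, hcol K J I hK, mul_zero]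
    · simp
  refine ⟨hv.star_apply, fun J I K hIK => ?_, hcol, hrs, hcs⟩
  have hp := projection_mul_eq_zero (p := fun I => v J I * star (v J I)) (by simp)
    (fun I => by
      rw [← mul_assoc, hpi]) (hrs J) hIK
  have h1 : star (v J I) = star (v J I) * (v J I * star (v J I)) := by
    conv_lhs => rw [← hpi, star_mul, star_mul, star_star]
  rw [h1, ← hpi J K, mul_assoc, ← mul_assoc (v J I * star (v J I)), hp, zero_mul, mul_zero]

variable (hv : IsCubicMatrix bar v)

section
include hv hbar

lemma row_orth' {J I K : ι} (h : I ≠ K) : v J I * star (v J K) = 0 := by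
  have := hv.row_orth (bar J) (bar I) (bar K) fun h' => h (by rw [← hbar I, h', hbar])
  rwa [hv.star_apply, hbar, hbar, ← hv.star_apply] at this

lemma col_orth' {J K I : ι} (h : J ≠ K) : v J I * star (v K I) = 0 := by
  have := hv.col_orth (bar J) (bar K) (bar I) fun h' => h (by rw [← hbar J, h', hbar])
  rwa [hv.star_apply, hbar, hbar, ← hv.star_apply] at this

lemma mul_bar_eq_zero {J I K : ι} (h : K ≠ bar I) : v J I * v (bar J) K = 0 := by
  rw [← hbar K, ← hv.star_apply]
  exact hv.row_orth' hbar fun h' => h (by rw [h', hbar])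

lemma row (K L : ι) : ∑ I, v K I * star (v L I) = if K = L then 1 else 0 := by
  split_ifs with h
  · subst h; exact hv.row_sum K
  · exact Finset.sum_eq_zero fun I _ => hv.col_orth' hbar h

lemma coactGen_mul_bar {e : ι → Γ} (he : ∀ J, e J * e (bar J) = 1) (I : ι) :
    coactGen e v I * coactGen e v (bar I) = 1 := by
  have h : ∀ J, ∑ K, (MonoidAlgebra.single (e J) (1 : ℂ) ⊗ₜ[ℂ] v J I) *
      (MonoidAlgebra.single (e K) (1 : ℂ) ⊗ₜ[ℂ] v K (bar I)) =
      1 ⊗ₜ[ℂ] (v J I * star (v J I)) := fun J => by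
    rw [Finset.sum_eq_single (bar J)]
    · rw [Algebra.TensorProduct.tmul_mul_tmul, MonoidAlgebra.single_mul_single, he, mul_one,
        hv.star_apply]
      rfl
    · intro K _ hK
      rw [Algebra.TensorProduct.tmul_mul_tmul, ← hbar K, ← hv.star_apply, hv.col_orth' hbar,
        TensorProduct.tmul_zero]
      exact fun h => hK (by rw [h, hbar])
    · simp
  rw [coactGen, coactGen, Finset.sum_mul_sum]
  simp only [h, ← TensorProduct.tmul_sum, hv.col_sum]
  rfl

/-- The matrix is an isometry matrix if the only relators are the cancellations. -/
lemma isIsometryMatrix_of_free {e : ι → Γ} (hT : IsDehnPresentation e bar (cancelWords bar)) :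
    IsIsometryMatrix e bar v := by
  refine hT.isIsometryMatrix hv.star_apply (hv.row hbar) ?_ ?_
  · rintro _ ⟨J, rfl⟩
    simpa using hv.coactGen_mul_bar hbar hT.mul_bar J
  · rintro _ ⟨J, rfl⟩ w' hw' hw
    obtain ⟨I, K, rfl⟩ := List.length_eq_two.1 hw'.symm
    have : K ≠ bar I := by
      rintro rfl
      exact hw ⟨I, rfl⟩
    simpa [pairProd] using hv.mul_bar_eq_zero hbar this

end

end IsCubicMatrix

end DehnPresentation

/-! ### The relators `J^s` and the relation `ξ ∈ Fix(v^{⊗ s})` -/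

section PowerRelations

variable {Γ : Type} [Group Γ] {ι : Type} [Fintype ι] [DecidableEq ι] {B : Type u}
  [CStarAlgebra B]

/-- The relators `J · bar J` and `J ⋯ J` (`s` times). -/
def powerWords (bar : ι → ι) (s : ℕ) : Set (List ι) :=
  cancelWords bar ∪ {w | ∃ J, w = List.replicate s J}

/-- Partial isometries with orthogonal supports and orthogonal ranges, whose `s`-th powers sum up
to `1`, are normal: both `a a*` and `a* a` are equal to `a^s`. -/
lemma pow_eq_of_sum_pow {a : ι → B} {s : ℕ} (hs : s ≠ 0)
    (h1 : ∀ i k, i ≠ k → star (a i) * a k = 0) (h2 : ∀ i k, i ≠ k → a i * star (a k) = 0)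
    (h3 : ∀ i, a i * star (a i) * a i = a i) (h : ∑ k, a k ^ s = 1) (i : ι) :
    a i ^ s = a i * star (a i) ∧ a i ^ s = star (a i) * a i := by
  obtain ⟨m, rfl⟩ := Nat.exists_eq_succ_of_ne_zero hs
  constructor
  · have hl := congrArg (fun x => a i * star (a i) * x) h
    simp only [Finset.mul_sum, mul_one] at hl
    rw [Finset.sum_eq_single i] at hl
    · rwa [pow_succ', ← mul_assoc, h3, ← pow_succ'] at hl
    · intro k _ hk
      rw [pow_succ', mul_assoc, ← mul_assoc (star (a i)), h1 i k hk.symm, zero_mul, mul_zero]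
    · simp
  · have hr := congrArg (fun x => x * (star (a i) * a i)) h
    simp only [Finset.sum_mul, one_mul] at hr
    rw [Finset.sum_eq_single i] at hr
    · rwa [pow_succ, mul_assoc, ← mul_assoc (a i), h3, ← pow_succ] at hr
    · intro k _ hk
      rw [pow_succ, mul_assoc, ← mul_assoc (a k), h2 k i hk, zero_mul, mul_zero]
    · simp

lemma prod_map_eq_zero_or_const {f : ι → B} (hf : ∀ J K, J ≠ K → f J * f K = 0) (J : ι)
    (L : List ι) : ((J :: L).map f).prod = 0 ∨ ∀ K ∈ L, K = J := by
  induction L generalizing J with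
  | nil => simp
  | cons K L ih =>
    rcases eq_or_ne J K with rfl | h
    · rcases ih J with h | h
      · left
        rw [List.map_cons, List.prod_cons, h, mul_zero]
      · right
        simpa using h
    · left
      rw [List.map_cons, List.prod_cons, List.map_cons, List.prod_cons, ← mul_assoc, hf J K h,
        zero_mul]

lemma prod_map_eq_zero {f : ι → B} (hf : ∀ J K, J ≠ K → f J * f K = 0) {L : List ι}
    (hne : L ≠ []) (hL : ∀ J, L ≠ List.replicate L.length J) : (L.map f).prod = 0 := by
  obtain ⟨J, L, rfl⟩ := List.exists_cons_of_ne_nil hne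
  refine (prod_map_eq_zero_or_const hf J L).resolve_right fun h => hL J ?_
  rw [List.eq_replicate_iff]
  simpa using h

lemma ofFn_eq_replicate_iff {s : ℕ} {J : Fin s → ι} {K : ι} :
    List.ofFn J = List.replicate s K ↔ J = fun _ => K := by
  rw [← List.ofFn_const, List.ofFn_inj]

lemma tensorPower_const (v : Matrix ι ι B) (s : ℕ) (J I : ι) :
    tensorPower v s (fun _ => J) (fun _ => I) = v J I ^ s := by
  rw [tensorPower, List.ofFn_const, List.prod_replicate]

lemma tensorPower_const_right (v : Matrix ι ι B) {s : ℕ} (J : Fin s → ι) (I : ι) :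
    tensorPower v s J (fun _ => I) = ((List.ofFn J).map fun K => v K I).prod := by
  rw [tensorPower, map_ofFn_eq]

lemma wordProd_const (e : ι → Γ) (s : ℕ) (J : ι) : wordProd e (fun _ : Fin s => J) = e J ^ s := by
  rw [wordProd, List.ofFn_const, List.prod_replicate]

lemma const_injective {s : ℕ} (hs : s ≠ 0) :
    Function.Injective (fun (K : ι) (_ : Fin s) => K) := fun _ _ h =>
  congrFun h ⟨0, Nat.pos_of_ne_zero hs⟩

lemma xiVec_const {s : ℕ} (hs : s ≠ 0) (J : ι) : xiVec ι s (fun _ => J) = 1 := by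
  rw [xiVec, Finset.sum_eq_single J]
  · simp
  · intro I _ hI; simp [hI.symm, hs]
  · simp

lemma xiVec_eq_zero {s : ℕ} {J : Fin s → ι} (hJ : J ∉ Set.range fun (K : ι) (_ : Fin s) => K) :
    xiVec ι s J = 0 := by
  refine Finset.sum_eq_zero fun I _ => ?_
  obtain ⟨r, hr⟩ : ∃ r, J r ≠ I := by
    by_contra h
    push Not at h
    exact hJ ⟨I, (funext h).symm⟩
  exact Finset.prod_eq_zero (Finset.mem_univ r) (if_neg hr)

/-- The vector `ξ` is supported on the constant indices, which are pairwise distinct because `s ≠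
0`. -/
lemma fixRelation_eq {s : ℕ} (hs : s ≠ 0) (v : Matrix ι ι B) (J : Fin s → ι) :
    fixRelation v s J =
      ∑ I, tensorPower v s J (fun _ => I) - algebraMap ℂ B (xiVec ι s J) := by
  rw [fixRelation, Matrix.mulVec, dotProduct]
  congr 1
  refine (Fintype.sum_of_injective _ (const_injective hs) _ _ (fun K hK => ?_) fun I => ?_).symm
  · rw [xiVec_eq_zero hK, map_zero, mul_zero]
  · rw [xiVec_const hs, map_one, mul_one]

lemma map_fixRelation {B' : Type u} [CStarAlgebra B'] (f : B →⋆ₐ[ℂ] B') (v : Matrix ι ι B)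
    {s : ℕ} (J : Fin s → ι) : f (fixRelation v s J) = fixRelation (v.map f) s J := by
  simp only [fixRelation, Matrix.mulVec, dotProduct, map_sub, map_sum, map_mul, map_tensorPower,
    AlgHomClass.commutes]

namespace IsCubicMatrix

variable {bar : ι → ι} (hbar : ∀ I, bar (bar I) = I) {v : Matrix ι ι B}
  (hv : IsCubicMatrix bar v) {s : ℕ} (hs : s ≠ 0)
include hbar hv

lemma mul_star_mul (J I : ι) : v J I * star (v J I) * v J I = v J I := by
  have h := congrArg (· * v J I) (hv.col_sum I)
  simp only [one_mul, Finset.sum_mul] at h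
  rwa [Finset.sum_eq_single J] at h
  · intro K _ hK; rw [mul_assoc, hv.col_orth K J I hK, mul_zero]
  · simp

/-- Normality lets one write `a = a(a*a) = a(aa*)`, and the final `a*` annihilates the other
entries. -/
lemma col_mul_eq_zero_of_normal (hn : ∀ J I, v J I * star (v J I) = star (v J I) * v J I)
    {J K I : ι} (h : J ≠ K) : v J I * v K I = 0 := by
  rw [← hv.mul_star_mul hbar J I, mul_assoc (v J I), ← hn, mul_assoc, mul_assoc,
    hv.col_orth J K I h, mul_zero, mul_zero]

lemma row_mul_eq_zero_of_normal (hn : ∀ J I, v J I * star (v J I) = star (v J I) * v J I)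
    {J I K : ι} (h : I ≠ K) : v J I * v J K = 0 := by
  rw [← hv.mul_star_mul hbar J I, mul_assoc (v J I), ← hn, mul_assoc, mul_assoc,
    hv.row_orth J I K h, mul_zero, mul_zero]

include hs

lemma pow_eq_of_col_sum_pow (h : ∀ I, ∑ J, v J I ^ s = 1) (J I : ι) :
    v J I ^ s = v J I * star (v J I) ∧ v J I ^ s = star (v J I) * v J I :=
  pow_eq_of_sum_pow (a := fun J => v J I) hs (fun J K h => hv.col_orth J K I h)
    (fun _ _ h => hv.col_orth' hbar h) (fun J => hv.mul_star_mul hbar J I) (h I) J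

lemma pow_eq_of_row_sum_pow (h : ∀ J, ∑ I, v J I ^ s = 1) (J I : ι) :
    v J I ^ s = v J I * star (v J I) ∧ v J I ^ s = star (v J I) * v J I :=
  pow_eq_of_sum_pow (a := fun I => v J I) hs (fun I K h => hv.row_orth J I K h)
    (fun _ _ h => hv.row_orth' hbar h) (fun I => hv.mul_star_mul hbar J I) (h J) I

/-- The `s`-th powers on each column of an isometry matrix sum up to `1`. -/
lemma col_sum_pow {e : ι → Γ} (hfix : ∀ I, bar I ≠ I)
    (hT : IsDehnPresentation e bar (powerWords bar s)) (hiso : IsIsometryMatrix e bar v) (I : ι) :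
    ∑ J, v J I ^ s = 1 := by
  classical
  have h := congrArg (tensorCoeff B 1) (hiso.rel (List.ofFn fun _ : Fin s => I) (by
    rw [List.ofFn_const]
    exact hT.prod_eq_one _ (Or.inr ⟨I, rfl⟩)))
  rw [map_ofFn_eq, prod_coactGen, map_sum, Algebra.TensorProduct.one_def, MonoidAlgebra.one_def,
    tensorCoeff_single_tmul, if_pos rfl] at h
  rw [← h]
  refine Fintype.sum_of_injective _ (const_injective hs) _ _ (fun J hJ => ?_) fun J => ?_
  · rw [tensorCoeff_single_tmul]
    split_ifs with h1
    swap; · rfl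
    rw [wordProd, ← map_ofFn_eq] at h1
    obtain ⟨w, hw, hwJ⟩ : ∃ w ∈ powerWords bar s, w <:+: List.ofFn J := by
      by_contra hcon
      push Not at hcon
      refine hT.prod_ne_one _ (fun h => hs ?_) hcon h1
      simpa using h
    -- A non-constant word `J` of length `s` representing 1 contains a cancellation, since a relator
    -- `K^s` would fill it. Against the constant word `I` the cancellation gives `v_{KI} v_{bar K,I}
    -- = 0`, because `bar I ≠ I`.
    rcases hw with ⟨K, rfl⟩ | ⟨K, rfl⟩
    · rw [tensorPower_const_right]
      obtain ⟨a, b, hab⟩ := hwJ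
      rw [← hab]
      simp only [List.map_append, List.map_cons, List.map_nil, List.prod_append, List.prod_cons,
        List.prod_nil, mul_one, hv.mul_bar_eq_zero hbar (hfix I).symm, mul_zero, zero_mul]
    · have := hwJ.eq_of_length (by simp)
      exact absurd ⟨K, (ofFn_eq_replicate_iff.1 this.symm).symm⟩ hJ
  · rw [tensorCoeff_single_tmul, if_pos, tensorPower_const]
    have := hT.prod_eq_one _ (Or.inr ⟨J, rfl⟩)
    rwa [List.map_replicate, List.prod_replicate, ← wordProd_const] at this

/-- The column sums give `v_{JI}^s = v_{JI}v_{JI}*`, which sums up to 1 along rows as well. At a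
non-constant index each product contains two different neighbouring entries of one column and
vanishes by normality. -/
lemma fixRelation_eq_zero {e : ι → Γ} (hfix : ∀ I, bar I ≠ I)
    (hT : IsDehnPresentation e bar (powerWords bar s)) (hiso : IsIsometryMatrix e bar v)
    (J : Fin s → ι) : fixRelation v s J = 0 := by
  have hpow := hv.pow_eq_of_col_sum_pow hbar hs (hv.col_sum_pow hbar hs hfix hT hiso)
  rw [fixRelation_eq hs, sub_eq_zero]
  by_cases hJ : J ∈ Set.range fun (K : ι) (_ : Fin s) => K
  · obtain ⟨K, rfl⟩ := hJ
    rw [xiVec_const hs, map_one]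
    simp only [tensorPower_const, (hpow _ _).1, hv.row_sum]
  · rw [xiVec_eq_zero hJ, map_zero]
    refine Finset.sum_eq_zero fun I _ => ?_
    rw [tensorPower_const_right]
    refine prod_map_eq_zero (fun K L h => hv.col_mul_eq_zero_of_normal hbar
      (fun J I => (hpow J I).1.symm.trans (hpow J I).2) h) (fun h => hs (by simpa using h))
      fun K h => hJ ⟨K, ?_⟩
    rw [List.length_ofFn, ofFn_eq_replicate_iff] at h
    exact h.symm

/-- The relations of `H_{n0}^+` and the relation `ξ ∈ Fix(v^{⊗ s})` give an isometry matrix. -/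
lemma isIsometryMatrix_of_fixRelation {e : ι → Γ}
    (hT : IsDehnPresentation e bar (powerWords bar s)) (hrel : ∀ J, fixRelation v s J = 0) :
    IsIsometryMatrix e bar v := by
  -- Only the coordinates at constant indices are used; the orthogonality of the cubic relations
  -- supplies the others.
  have hrow : ∀ J, ∑ I, v J I ^ s = 1 := fun J => by
    have h := hrel fun _ => J
    rw [fixRelation_eq hs, sub_eq_zero, xiVec_const hs, map_one] at h
    simpa only [tensorPower_const] using h
  have hpow := hv.pow_eq_of_row_sum_pow hbar hs hrow
  have hn : ∀ J I, v J I * star (v J I) = star (v J I) * v J I := fun J I =>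
    (hpow J I).1.symm.trans (hpow J I).2
  refine hT.isIsometryMatrix hv.star_apply (hv.row hbar) ?_ ?_
  · rintro _ (⟨I, rfl⟩ | ⟨I, rfl⟩)
    · simpa using hv.coactGen_mul_bar hbar hT.mul_bar I
    · rw [← List.ofFn_const, map_ofFn_eq, prod_coactGen]
      have h1 : ∑ K, (1 : MonoidAlgebra ℂ Γ) ⊗ₜ[ℂ] (v K I ^ s) = 1 := by
        simp only [(hpow _ _).1, ← TensorProduct.tmul_sum, hv.col_sum]
        rfl
      rw [← h1]
      refine (Fintype.sum_of_injective _ (const_injective hs) _ _ (fun J hJ => ?_)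
        fun J => ?_).symm
      · rw [tensorPower_const_right, prod_map_eq_zero, TensorProduct.tmul_zero]
        · exact fun K L h => hv.col_mul_eq_zero_of_normal hbar hn h
        · exact fun h => hs (by simpa using h)
        · intro K h
          rw [List.length_ofFn, ofFn_eq_replicate_iff] at h
          exact hJ ⟨K, h.symm⟩
      · rw [tensorPower_const, wordProd_const]
        have := hT.prod_eq_one _ (Or.inr ⟨J, rfl⟩)
        rw [List.map_replicate, List.prod_replicate] at this
        rw [this]
        rfl
  · rintro _ (⟨J, rfl⟩ | ⟨J, rfl⟩) w hw hwT
    · obtain ⟨I, K, rfl⟩ := List.length_eq_two.1 hw.symm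
      have : K ≠ bar I := by
        rintro rfl
        exact hwT (Or.inl ⟨I, rfl⟩)
      simpa [pairProd] using hv.mul_bar_eq_zero hbar this
    · rw [List.length_replicate] at hw
      have h1 : pairProd v (List.replicate s J) w = (w.map fun I => v J I).prod := by
        rw [pairProd]
        congr 1
        exact List.ext_getElem (by simp [hw]) (by simp)
      rw [h1]
      refine prod_map_eq_zero (fun K L h => hv.row_mul_eq_zero_of_normal hbar hn h) ?_ ?_
      · rintro rfl
        exact hs hw
      · intro K hK
        exact hwT (Or.inr ⟨K, by rwa [← hw] at hK⟩)

end IsCubicMatrix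

end PowerRelations

/-! ### Dehn presentations of `ℤ_s^{*n}` and `F_n` -/

section FreeProducts

/-- The involution of the index set with `g_{bar I} = g_I⁻¹`. -/
def symmBar {n : ℕ} (I : Fin n × Fin 2) : Fin n × Fin 2 := (I.1, I.2.rev)

lemma symmBar_symmBar {n : ℕ} (I : Fin n × Fin 2) : symmBar (symmBar I) = I := by
  simp [symmBar]

lemma symmBar_ne {n : ℕ} (I : Fin n × Fin 2) : symmBar I ≠ I := by
  obtain ⟨i, a⟩ := I
  fin_cases a <;> simp [symmBar]

lemma eq_symmBar_of_ne {n : ℕ} {I J : Fin n × Fin 2} (h1 : I.1 = J.1) (h : I ≠ J) :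
    J = symmBar I := by
  obtain ⟨i, a⟩ := I
  obtain ⟨j, b⟩ := J
  change i = j at h1
  subst h1
  fin_cases a <;> fin_cases b <;> simp_all [symmBar]

lemma symmFamily_mul_symmBar {Γ : Type} [Group Γ] {n : ℕ} (g : Fin n → Γ) (I : Fin n × Fin 2) :
    symmFamily g I * symmFamily g (symmBar I) = 1 := by
  obtain ⟨i, a⟩ := I
  fin_cases a <;> simp [symmBar, symmFamily]

/-- If `g` generates `Γ`, each element is a word in the elements `g_{ia}`. -/
lemma exists_word_symmFamily {Γ : Type} [Group Γ] {n : ℕ} {g : Fin n → Γ}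
    (hg : Subgroup.closure (Set.range g) = ⊤) (x : Γ) :
    ∃ L : List (Fin n × Fin 2), (L.map (symmFamily g)).prod = x := by
  have hx : x ∈ Subgroup.closure (Set.range g) := by rw [hg]; trivial
  induction hx using Subgroup.closure_induction with
  | one => exact ⟨[], rfl⟩
  | mem x h =>
    obtain ⟨i, rfl⟩ := h
    exact ⟨[(i, 0)], by simp [symmFamily]⟩
  | mul x y _ _ hx hy =>
    obtain ⟨L, rfl⟩ := hx
    obtain ⟨M, rfl⟩ := hy
    exact ⟨L ++ M, by simp⟩
  | inv x hmem hx =>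
    obtain ⟨L, rfl⟩ := hx
    clear hmem
    refine ⟨(L.map symmBar).reverse, ?_⟩
    induction L with
    | nil => simp
    | cons I L ih =>
      simp only [List.map_cons, List.reverse_cons, List.map_append, List.prod_append, ih,
        List.map_nil, List.prod_cons, List.prod_nil, mul_one, mul_inv_rev]
      rw [eq_inv_of_mul_eq_one_right (symmFamily_mul_symmBar g I)]

/-- The exponent `±1` of the generator `g_{ia}`. -/
def symmSign (s : ℕ) (a : Fin 2) : ZMod s := if a = 0 then 1 else -1

lemma symmFamily_cyclicGen (s n : ℕ) (I : Fin n × Fin 2) : symmFamily (cyclicGen s n) I =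
    Monoid.CoprodI.of (i := I.1) (Multiplicative.ofAdd (symmSign s I.2)) := by
  obtain ⟨i, a⟩ := I
  fin_cases a
  · simp [symmFamily, symmSign, cyclicGen]
  · simp [symmFamily, symmSign, cyclicGen, ofAdd_neg]

lemma natCast_mul_symmSign_ne_zero {s m : ℕ} (hm : m ≠ 0) (hms : m < s) (a : Fin 2) :
    (m : ZMod s) * symmSign s a ≠ 0 := by
  have h : (m : ZMod s) ≠ 0 := fun h =>
    hm (Nat.eq_zero_of_dvd_of_lt ((ZMod.natCast_eq_zero_iff m s).1 h) hms)
  rw [symmSign]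
  split_ifs <;> simpa using h

open Monoid.CoprodI in
/-- The normal form in `ℤ_s^{*n}` of a word without relators as subwords: the first syllable is the
maximal initial power of a generator. -/
lemma exists_normal_form {s n : ℕ} (hs : 1 < s) (J : Fin n × Fin 2) (L : List (Fin n × Fin 2))
    (hL : ∀ w ∈ powerWords symmBar s, ¬ w <:+: J :: L) :
    ∃ (m : ℕ) (R : List (Fin n × Fin 2)) (w : Word fun _ : Fin n => Multiplicative (ZMod s)),
      m ≠ 0 ∧ m < s ∧ J :: L = List.replicate m J ++ R ∧ w.fstIdx ≠ some J.1 ∧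
      ((J :: L).map (symmFamily (cyclicGen s n))).prod =
        of (i := J.1) (Multiplicative.ofAdd ((m : ZMod s) * symmSign s J.2)) * w.prod := by
  induction L generalizing J with
  | nil =>
    refine ⟨1, [], Word.empty, one_ne_zero, hs, rfl, by simp [Word.fstIdx], ?_⟩
    simp [symmFamily_cyclicGen]
  | cons K L ih =>
    obtain ⟨m, R, w, hm, hms, hR, hw, hprod⟩ := ih K fun w hw h =>
      hL w hw (h.trans (List.suffix_cons J _).isInfix)
    by_cases hJK : J = K
    · subst hJK
      have hR' : J :: J :: L = List.replicate (m + 1) J ++ R := by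
        rw [hR, List.replicate_succ, List.cons_append]
      have hms' : m + 1 < s := by
        -- The first syllable cannot grow to length `s`, as it would then be a relator; so its
        -- exponent stays nonzero modulo `s`.
        refine lt_of_le_of_ne hms fun h => hL (List.replicate s J) (Or.inr ⟨J, rfl⟩) ?_
        rw [hR', h]
        exact (List.prefix_append _ _).isInfix
      refine ⟨m + 1, R, w, m.succ_ne_zero, hms', hR', hw, ?_⟩
      rw [List.map_cons, List.prod_cons, hprod, symmFamily_cyclicGen, ← mul_assoc, ← map_mul,
        ← ofAdd_add]
      congr 4
      push_cast
      ring
    -- Two different letters from the same factor are mutually inverse, hence a relator. So a change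
    -- of letter is a change of factor, and a new syllable starts.
    · have h1 : J.1 ≠ K.1 := fun h => by
        have hK := eq_symmBar_of_ne h hJK
        refine hL [J, K] (Or.inl ⟨J, by rw [hK]⟩) ?_
        exact (List.prefix_append [J, K] L).isInfix
      have hne : Multiplicative.ofAdd ((m : ZMod s) * symmSign s K.2) ≠ 1 := fun h =>
        natCast_mul_symmSign_ne_zero hm hms K.2 h
      refine ⟨1, K :: L, Word.cons _ w hw hne, one_ne_zero, hs, rfl, ?_, ?_⟩
      · rw [Word.fstIdx_cons]
        exact fun h => h1 (Option.some_injective _ h).symm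
      · rw [List.map_cons, List.prod_cons, hprod, Word.prod_cons, symmFamily_cyclicGen, Nat.cast_one,
          one_mul]

open Monoid.CoprodI in
-- The normal form is a nonempty reduced word, and reduced words in a free product represent
-- distinct elements.
lemma cyclicGen_prod_ne_one {s n : ℕ} (hs : 1 < s) {L : List (Fin n × Fin 2)} (hne : L ≠ [])
    (hL : ∀ w ∈ powerWords symmBar s, ¬ w <:+: L) :
    (L.map (symmFamily (cyclicGen s n))).prod ≠ 1 := by
  classical
  obtain ⟨J, L, rfl⟩ := List.exists_cons_of_ne_nil hne
  obtain ⟨m, R, w, hm, hms, -, hw, hprod⟩ := exists_normal_form hs J L hL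
  have hone : Multiplicative.ofAdd ((m : ZMod s) * symmSign s J.2) ≠ 1 := fun h =>
    natCast_mul_symmSign_ne_zero hm hms J.2 h
  have hinj : Function.Injective
      (Word.prod : Word (fun _ : Fin n => Multiplicative (ZMod s)) → _) :=
    Word.equiv.symm.injective
  rw [hprod, ← Word.prod_cons _ _ _ hone hw, ← Word.prod_empty]
  intro h
  have h1 := congrArg Word.toList (hinj h)
  simp at h1

lemma isDehnPresentation_cyclicGen {s n : ℕ} (hs : 5 ≤ s) :
    IsDehnPresentation (symmFamily (cyclicGen s n)) symmBar (powerWords symmBar s) where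
  cancel_subset := Set.subset_union_left
  length_le := by
    rintro w (hw | ⟨J, rfl⟩)
    · exact Or.inl hw
    · exact Or.inr (by simpa using hs)
  prod_eq_one := by
    rintro w (⟨J, rfl⟩ | ⟨J, rfl⟩)
    · simpa using symmFamily_mul_symmBar (cyclicGen s n) J
    · rw [List.map_replicate, List.prod_replicate, symmFamily_cyclicGen, ← map_pow, ← ofAdd_nsmul]
      simp
  prod_ne_one L hne hL := cyclicGen_prod_ne_one (by omega) hne hL

/-- Freeness is tested in a quotient `ℤ_s^{*n}` with `s` larger than the length of the given word,
where no relator `J^s` can occur in it. -/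
lemma isDehnPresentation_freeGen (n : ℕ) :
    IsDehnPresentation (symmFamily (freeGen n)) symmBar (cancelWords symmBar) where
  cancel_subset := subset_rfl
  length_le w hw := Or.inl hw
  prod_eq_one := by
    rintro _ ⟨J, rfl⟩
    simpa using symmFamily_mul_symmBar (freeGen n) J
  prod_ne_one L hne hL h := by
    -- Any order exceeding both 1 and the length of `L` would do.
    let s := L.length + 2
    let φ : FreeGroup (Fin n) →* CyclicFreePower s n := FreeGroup.lift (cyclicGen s n)
    have hφ : ∀ I, φ (symmFamily (freeGen n) I) = symmFamily (cyclicGen s n) I := fun I => by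
      rw [symmFamily, symmFamily, apply_ite φ, map_inv]
      simp [φ, freeGen]
    refine cyclicGen_prod_ne_one (s := s) (n := n) (by omega) hne ?_ ?_
    · rintro w (hw | ⟨J, rfl⟩) hwL
      · exact hL w hw hwL
      · have := hwL.length_le
        rw [List.length_replicate] at this
        omega
    · have := congrArg φ h
      simpa only [map_list_prod, List.map_map, Function.comp_def, hφ, map_one] using this

lemma isSymmGen_freeGen (n : ℕ) : IsSymmGen (symmFamily (freeGen n)) symmBar :=
  (isDehnPresentation_freeGen n).isSymmGen symmBar_symmBar
    (exists_word_symmFamily (FreeGroup.closure_range_of (Fin n)))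

lemma isSymmGen_cyclicGen {s n : ℕ} (hs : 5 ≤ s) :
    IsSymmGen (symmFamily (cyclicGen s n)) symmBar := by
  have : NeZero s := ⟨by omega⟩
  refine (isDehnPresentation_cyclicGen hs).isSymmGen symmBar_symmBar (exists_word_symmFamily ?_)
  rw [eq_top_iff]
  intro x _
  induction x using Monoid.CoprodI.induction_on with
  | one => exact one_mem _
  | mul x y hx hy => exact mul_mem (hx trivial) (hy trivial)
  | of i m =>
    have : m = Multiplicative.ofAdd (1 : ZMod s) ^ (Multiplicative.toAdd m).val := by
      rw [← ofAdd_nsmul]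
      simp
    rw [this, map_pow]
    exact pow_mem (Subgroup.subset_closure (Set.mem_range_self (f := cyclicGen s n) i)) _

end FreeProducts

end

/-! ### Comparison of the two universal properties -/

theorem theorem2p5 (s n : ℕ) (hs : 5 ≤ s) (hn : 2 ≤ n) :
    (∃ (H : CompactQuantumGroup.{u}) (α : IsometricAction (Set.range (symmFamily (freeGen n))) H),
      IsQuantumIsometryGroup (Set.range (symmFamily (freeGen n))) H α) ∧
    (∃ (G : CompactQuantumGroup.{u})
      (β : IsometricAction (Set.range (symmFamily (cyclicGen s n))) G),
      IsQuantumIsometryGroup (Set.range (symmFamily (cyclicGen s n))) G β) ∧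
    ∀ (H : CompactQuantumGroup.{u})
      (α : IsometricAction (Set.range (symmFamily (freeGen n))) H)
      (G : CompactQuantumGroup.{u})
      (β : IsometricAction (Set.range (symmFamily (cyclicGen s n))) G),
      IsQuantumIsometryGroup (Set.range (symmFamily (freeGen n))) H α →
      IsQuantumIsometryGroup (Set.range (symmFamily (cyclicGen s n))) G β →
      ∃ p : CQGHom H G,
        (∀ J I, p.toHom (α.fundamental J I) = β.fundamental J I) ∧
        IsPresentedSubgroup p (Set.range (fixRelation α.fundamental s)) := by
  have heF := isSymmGen_freeGen n
  have heZ := isSymmGen_cyclicGen (n := n) hs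
  have hTF := isDehnPresentation_freeGen n
  have hTZ := isDehnPresentation_cyclicGen (n := n) hs
  have hs0 : s ≠ 0 := by omega
  refine ⟨?_, ?_, fun H α G β hα hβ => ?_⟩
  · obtain ⟨H, α, h⟩ := heF.exists_quantumIsometryGroup.{u}
    exact ⟨H, α, h.isQuantumIsometryGroup heF⟩
  · obtain ⟨G, β, h⟩ := heZ.exists_quantumIsometryGroup.{u}
    exact ⟨G, β, h.isQuantumIsometryGroup heZ⟩
  · have hβu := hβ.isUniversalMatrix heZ
    have hβc := IsCubicMatrix.of_isIsometryMatrix heZ hTZ hβu.isometry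
    -- The cubic relations do not mention the group, so the matrix of the action on the dual of
    -- `ℤ_s^{*n}` also defines an action on the dual of `F_n`. Universality of `H` then provides
    -- `p`.
    let γ : IsometricAction (Set.range (symmFamily (freeGen n))) G :=
      IsometricAction.ofMatrix heF (hβc.isIsometryMatrix_of_free symmBar_symmBar hTF)
        (β.comul_matrix heZ)
    have hγ : γ.matrix (symmFamily (freeGen n)) = β.fundamental :=
      IsometricAction.matrix_ofMatrix heF _ _
    obtain ⟨p, hp, -⟩ := hα G γ
    have hpu : ∀ J I, p.toHom (α.fundamental J I) = β.fundamental J I := fun J I =>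
      (α.map_matrix_eq γ p.toHom hp J I).trans (congrFun (congrFun hγ J) I)
    have hpm : α.fundamental.map p.toHom = β.fundamental := Matrix.ext hpu
    have hsurj : Function.Surjective p.toHom := by
      -- The range contains all polynomials in the generating matrix of `G`.
      refine p.toHom.surjective_of_denseRange (hβu.dense.mono ?_)
      rintro _ ⟨x, rfl⟩
      refine ⟨evalMatrix α.fundamental x, ?_⟩
      rw [map_evalMatrix, hpm]
      rfl
    refine ⟨p, hpu, hsurj, ?_, fun B _ f hf => ?_⟩
    · rintro _ ⟨J, rfl⟩
      rw [map_fixRelation, hpm]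
      exact hβc.fixRelation_eq_zero symmBar_symmBar hs0 symmBar_ne hTZ hβu.isometry J
    · have hw : IsIsometryMatrix (symmFamily (freeGen n)) symmBar (α.fundamental.map f) :=
        (α.isIsometryMatrix heF).map f
      -- Once `f` kills the relations, the image of the universal matrix of `F_n` satisfies the
      -- conditions for `ℤ_s^{*n}`, so universality of `G` yields the factorization.
      have hwZ : IsIsometryMatrix (symmFamily (cyclicGen s n)) symmBar (α.fundamental.map f) :=
        (IsCubicMatrix.of_isIsometryMatrix heF hTF hw).isIsometryMatrix_of_fixRelation
          symmBar_symmBar hs0 hTZ fun J => by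
            rw [← map_fixRelation]
            exact hf _ ⟨J, rfl⟩
      obtain ⟨k, hk⟩ := hβu.exists_hom B _ hwZ
      refine ⟨k, ?_, fun k' hk' => ?_⟩
      · refine starAlgHom_ext_of_dense (hα.isUniversalMatrix heF).dense fun J I => ?_
        exact (congrArg k (hpu J I)).trans (hk J I)
      · ext y
        obtain ⟨x, rfl⟩ := hsurj y
        have h1 : k'.comp p.toHom = k.comp p.toHom := by
          rw [hk']
          refine starAlgHom_ext_of_dense (hα.isUniversalMatrix heF).dense fun J I => ?_
          exact ((congrArg k (hpu J I)).trans (hk J I)).symm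
        exact DFunLike.congr_fun h1 x
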